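/- **Model.** A base station serves a finite set of users $\mathcal I$, partitioned into AoI users $\mathcal I_A\neq\emptyset$, latency users $\mathcal I_L$ and throughput users $\mathcal I_R$. Time is slotted, $t=1,2,\dots$. At the start of each slot a packet for user $\ell$ arrives with probability $q_\ell\in(0,1]$ ($q_k=1$ for $k\in\mathcal I_R$). In each slot at most one packet that has arrived and has not yet been received can be transmitted; a transmission to $\ell$ succeeds, within the slot, with probability $p_\ell\in(0,1]$. All arrivals and transmission outcomes are independent. Let $\rho_\ell>0$ ($\ell\in\mathcal I_A$), $\rho_j\ge0$ ($j\in\mathcal I_L$), $\alpha_k>0$ ($k\in\mathcal I_R$), and assume $\zeta:=1-\sum_{j\in\mathcal I_L}q_j/p_j-\sum_{k\in\mathcal I_R}\alpha_k/p_k>0$. For $\ell\in\mathcal I$ let $\mathcal R_\ell(t)$ be the set of packets received by $\ell$ until slot $t$ and $\lambda_\ell(t)$ the arrival slot of the most recently arrived packet in $\mathcal R_\ell(t-1)$ ($0$ if there is none). The age of $\ell$ in slot $t$ is $A_\ell(t)=t-\lambda_\ell(t)$. The latency of a packet that arrives in slot $g$ and is received in slot $r$ is $r-g+1$; in averages until slot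 $t$, put $r=t$ for packets not yet received. A causal policy decides in each slot, possibly using independent randomization, what to transmit, from the arrivals until this slot and the outcomes of its earlier transmissions. It is feasible ($\pi\in\Pi_F$) if almost surely, as $t\to\infty$, the average age $\frac1t\sum_{\tau\le t}A_i(\tau)$ of each $i\in\mathcal I_A$ and the average latency of the packets arrived until $t$ of each $j\in\mathcal I_L$ converge to finite limits, and $|\mathcal R_k(t)|/t$ converges to a limit $\ge\alpha_k$ for each $k\in\mathcal I_R$. For a growing family of sets $\mathcal D_\ell(t)$ of packets of user $\ell$, with arrival slots $g_{\ell1}<g_{\ell2}<\cdots$, put $g_{\ell0}=0$, $T_{\ell i}=g_{\ell i}-g_{\ell(i-1)}$ and $$\overline T_\ell=\lim_{t\to\infty}\frac{\sum_{i\in\mathcal D_\ell(t)}T_{\ell i}}{|\mathcal D_\ell(t)|},\qquad \overline{(\delta_\ell)^2}=\lim_{t\to\infty}\frac{\sum_{i\in\mathcal D_\ell(t)}(T_{\ell i}-\overline T_\ell)^2}{|\mathcal D_\ell(t)|},\qquad F_1=\sum_{\ell\in\mathcal I_A}\frac{\rho_\ell}2\Big[\overline T_\ell+\frac{\overline{(\delta_\ell)^2}}{\overline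 T_\ell}+1\Big].$$ For a policy $\pi$, $F_1^\pi$ is the value of $F_1$ for $\mathcal D_\ell=\mathcal R_\ell^\pi$ ($+\infty$ where the limits do not exist). **Target.** Let $(\overline T_\ell^\star)_{\ell\in\mathcal I_A}$ minimize $\sum_{\ell\in\mathcal I_A}\frac{\rho_\ell}2\big(\overline T_\ell+\frac{(1-q_\ell)/q_\ell^2}{\overline T_\ell}\big)$ subject to $\sum_{\ell\in\mathcal I_A}\frac1{p_\ell\overline T_\ell}\le\zeta$ and $\overline T_\ell\ge1$ for all $\ell\in\mathcal I_A$. **Policy $\pi_H$.** For each $\ell\in\mathcal I_A$ keep a counter $b_\ell$ and the slot $a_\ell$ of its last increment (initially $0$), and at most one high priority packet (initially none). If a packet arrives for $\ell\in\mathcal I_A$ in slot $t$: first, if $t-a_\ell>\lceil\overline T_\ell^\star-1/q_\ell\rceil$, increase $b_\ell$ by $1$ and set $a_\ell=t$; then, if $b_\ell>|\mathcal R_\ell(t-1)|$, the arriving packet becomes the high priority packet of $\ell$ (replacing any older one), and $\ell$ gets index $W_\ell=\rho_\ell p_\ell(t-\lambda_\ell(t))$. After a successful transmission to $\ell\in\mathcal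 I_A$ there is no high priority packet and $W_\ell=0$ until a packet is admitted again. A user $j\in\mathcal I_L$ has index $W_j=\rho_jp_j/q_j$ while it has unreceived packets, and $0$ otherwise. If $\max_{\ell\in\mathcal I_A\cup\mathcal I_L}W_\ell>0$, transmit the high priority packet (for $\mathcal I_L$: the latest unreceived packet) of a user with the largest $W_\ell$; otherwise transmit a packet of a user $k\in\mathcal I_R$ (if any) that maximizes $\alpha_kt/p_k-\hat R_k$, where $\hat R_k$ is the number of previous transmission attempts to $k$. Ties are broken arbitrarily. Call the packets of $\ell\in\mathcal I_A$ that arrive in the slots in which $b_\ell$ is incremented *selected*, and let $\mathcal S_\ell(t)$ be the set of those that arrived until slot $t$. **Theorem.** (1) Almost surely, for $\mathcal D_\ell=\mathcal S_\ell$ the limits exist and, for all $\ell\in\mathcal I_A$, $\overline T_\ell\in[\overline T_\ell^\star,\overline T_\ell^\star+1)$ and $\overline{(\delta_\ell)^2}=(1-q_\ell)/q_\ell^2$; moreover the corresponding value of $F_1$ is less than $$B:=\sum_{\ell\in\mathcal I_A}\frac{\rho_\ell}2\Big[(\overline T_\ell^\star+1)+\frac{(1-q_\ell)/q_\ell^2}{\overline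 T_\ell^\star}+1\Big].$$ (2) The same holds for the packets delivered under $\pi_H$, if the selected packets are all transmitted: for almost every sample path and each $\ell\in\mathcal I_A$, if every selected packet of $\ell$ is eventually received, then for $\mathcal D_\ell=\mathcal R_\ell^H$ the limits exist, $\overline T_\ell^H\in[\overline T_\ell^\star,\overline T_\ell^\star+1)$ and $\overline{(\delta_\ell^H)^2}=(1-q_\ell)/q_\ell^2$; and if this is so for every $\ell\in\mathcal I_A$, then $F_1^H<B$. (3) $B<2\inf_{\pi\in\Pi_F}F_1^\pi$ (where $F_1^\pi$ is random, its essential infimum is taken; the infimum over the empty set is $+\infty$). -/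

import Mathlib

open MeasureTheory ProbabilityTheory Filter Topology

noncomputable section

namespace Downlink

/-- The quality-of-service class of a user: age of information, latency, or throughput. -/
inductive Kind where
  | aoi
  | lat
  | thr
  deriving DecidableEq

/-- A downlink with set of users `I`: the class of each user (a partition of the users into three
classes), arrival probabilities `q`, transmission success probabilities `p`, weights `ρ` (relevant
for the AoI and latency users) and required throughputs `α` (relevant for the throughput users). -/
structure Network (I : Type*) where
  kind : I → Kind
  q : I → ℝ
  p : I → ℝ
  ρ : I → ℝ
  α : I → ℝ

/-! ### Sample paths of the system. Slots are `1, 2, 3, …`; a packet of user `ℓ` is identified with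
its arrival slot, since at most one packet arrives for a user in a slot. -/

/-- A sample path: `arr t ℓ` says whether a packet arrives for user `ℓ` at the start of slot `t`,
`tx t` is the packet (user, arrival slot) transmitted in slot `t`, if any, and `ok t` says whether
the transmission of slot `t` succeeds. -/
structure Run (I : Type*) where
  arr : ℕ → I → Bool
  tx : ℕ → Option (I × ℕ)
  ok : ℕ → Bool

namespace Run

variable {I : Type*} [DecidableEq I]

open Classical in
/-- The packets received by user `ℓ` until (the end of) slot `t`. -/
def delivered (r : Run I) (ℓ : I) (t : ℕ) : Finset ℕ :=
  (Finset.Icc 1 t).filter fun g => ∃ s ∈ Finset.Icc 1 t, r.tx s = some (ℓ, g) ∧ r.ok s = true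

/-- Arrival time of the latest packet received by user `ℓ` by the end of slot `t - 1`
(`0` if there is none). -/
def latestReceived (r : Run I) (ℓ : I) (t : ℕ) : ℕ := (r.delivered ℓ (t - 1)).sup id

/-- Age of information. -/
def age (r : Run I) (ℓ : I) (t : ℕ) : ℝ := (t : ℝ) - (r.latestReceived ℓ t : ℝ)

/-- Average age of information until slot `t`. -/
def avgAge (r : Run I) (ℓ : I) (t : ℕ) : ℝ := (∑ s ∈ Finset.Icc 1 t, r.age ℓ s) / (t : ℝ)

/-- The packets that have arrived for user `ℓ` until slot `t`. -/
def arrived (r : Run I) (ℓ : I) (t : ℕ) : Finset ℕ :=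
  (Finset.Icc 1 t).filter fun g => r.arr g ℓ = true

/-- The slot in which packet `g` of user `ℓ` is received, as seen at time `t`: this is `t` itself
if the packet has not been received until slot `t`. -/
def receivedSlot (r : Run I) (ℓ : I) (g t : ℕ) : ℕ :=
  if g ∈ r.delivered ℓ t then
    ((Finset.Icc 1 t).filter fun s => r.tx s = some (ℓ, g) ∧ r.ok s = true).sup id
  else t

/-- Latency of packet `g` of user `ℓ`, as seen at time `t`. -/
def latency (r : Run I) (ℓ : I) (g t : ℕ) : ℝ := (r.receivedSlot ℓ g t : ℝ) - (g : ℝ) + 1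

/-- Average latency until slot `t` of all packets that have arrived. -/
def avgLatency (r : Run I) (ℓ : I) (t : ℕ) : ℝ :=
  (∑ g ∈ r.arrived ℓ t, r.latency ℓ g t) / ((r.arrived ℓ t).card : ℝ)

/-- Throughput until slot `t`. -/
def throughput (r : Run I) (ℓ : I) (t : ℕ) : ℝ := ((r.delivered ℓ t).card : ℝ) / (t : ℝ)

/-- Number of transmission attempts to user `ℓ` until slot `t`. -/
def attempts (r : Run I) (ℓ : I) (t : ℕ) : ℕ :=
  ((Finset.Icc 1 t).filter fun s => (r.tx s).map Prod.fst = some ℓ).card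

end Run

/-! ### Causal policies -/

/-- The arrivals of the slots `t, t - 1, …, 1`, in this order. -/
def arrivalHistory {I : Type*} (arr : ℕ → I → Bool) : ℕ → List (I → Bool)
  | 0 => []
  | t + 1 => arr (t + 1) :: arrivalHistory arr t

/-- Success of a transmission in slot `t`, when `ch ℓ t` says whether a transmission to `ℓ` in slot
`t` would succeed. -/
def outcome {I : Type*} (ch : I → ℕ → Bool) (t : ℕ) : Option (I × ℕ) → Bool
  | none => false
  | some (ℓ, _) => ch ℓ t

/-- The outcomes of the transmissions of the slots `t, t - 1, …, 1`, in this order, when the decision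
rule `choose` is used. In slot `t` the rule sees a random seed `u`, the arrivals of the slots up to
and including `t`, and the outcomes of its own transmissions in earlier slots. -/
def feedbackHistory {I : Type*} (choose : ℝ → List (I → Bool) → List Bool → Option (I × ℕ))
    (u : ℝ) (arr : ℕ → I → Bool) (ch : I → ℕ → Bool) : ℕ → List Bool
  | 0 => []
  | t + 1 =>
    outcome ch (t + 1) (choose u (arrivalHistory arr (t + 1)) (feedbackHistory choose u arr ch t))
      :: feedbackHistory choose u arr ch t

/-- The packet transmitted in slot `t`, when the decision rule `choose` is used. -/
def transmission {I : Type*} (choose : ℝ → List (I → Bool) → List Bool → Option (I × ℕ))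
    (u : ℝ) (arr : ℕ → I → Bool) (ch : I → ℕ → Bool) : ℕ → Option (I × ℕ)
  | 0 => none
  | t + 1 => choose u (arrivalHistory arr (t + 1)) (feedbackHistory choose u arr ch t)

/-- The sample path generated by a decision rule. -/
def runOf {I : Type*} (choose : ℝ → List (I → Bool) → List Bool → Option (I × ℕ))
    (u : ℝ) (arr : ℕ → I → Bool) (ch : I → ℕ → Bool) : Run I where
  arr := arr
  tx := transmission choose u arr ch
  ok t := outcome ch t (transmission choose u arr ch t)

/-- A (possibly randomized) causal scheduling policy: a decision rule that uses causal information
only, and transmits only packets which have arrived and have not yet been received. -/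
structure Policy (I : Type*) [DecidableEq I] where
  choose : ℝ → List (I → Bool) → List Bool → Option (I × ℕ)
  measurable_choose : ∀ as fs x, MeasurableSet {u : ℝ | choose u as fs = x}
  admissible : ∀ u arr ch (t : ℕ) (ℓ : I) (g : ℕ), 1 ≤ t →
    (runOf choose u arr ch).tx t = some (ℓ, g) →
      1 ≤ g ∧ g ≤ t ∧ arr g ℓ = true ∧ g ∉ (runOf choose u arr ch).delivered ℓ (t - 1)

/-- The sample path generated by a policy from a seed, the arrivals and the channel states. -/
def Policy.run {I : Type*} [DecidableEq I] (π : Policy I) (u : ℝ) (arr : ℕ → I → Bool)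
    (ch : I → ℕ → Bool) : Run I :=
  runOf π.choose u arr ch

/-! ### Inter-arrival times of a growing set of packets -/

/-- For `g ∈ D`, the time between the arrival `g` and the preceding element of `D`
(or time `0`, if `g` is the first element of `D`). -/
def gap (D : Finset ℕ) (g : ℕ) : ℝ := (g : ℝ) - (((D.filter (· < g)).sup id : ℕ) : ℝ)

/-- The long-run average inter-arrival time of the packets in `D t`, `t → ∞`, exists and is `m`. -/
def HasMeanGap (D : ℕ → Finset ℕ) (m : ℝ) : Prop :=
  Tendsto (fun t => (∑ g ∈ D t, gap (D t) g) / ((D t).card : ℝ)) atTop (𝓝 m)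

/-- The long-run average of the squared deviations of the inter-arrival times from `m` exists and
is `v`. -/
def HasGapVariance (D : ℕ → Finset ℕ) (m v : ℝ) : Prop :=
  Tendsto (fun t => (∑ g ∈ D t, (gap (D t) g - m) ^ 2) / ((D t).card : ℝ)) atTop (𝓝 v)

namespace Network

variable {I : Type*} [Fintype I] [DecidableEq I] (N : Network I)

/-- The users of a given class. -/
def users (k : Kind) : Finset I := Finset.univ.filter fun ℓ => N.kind ℓ = k

/-- The fraction of slots left for the AoI users. -/
def ζ : ℝ := 1 - ∑ j ∈ N.users .lat, N.q j / N.p j - ∑ k ∈ N.users .thr, N.α k / N.p k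

/-- Standing assumptions on the parameters. -/
structure Valid : Prop where
  q_pos : ∀ ℓ, 0 < N.q ℓ
  q_le : ∀ ℓ, N.q ℓ ≤ 1
  p_pos : ∀ ℓ, 0 < N.p ℓ
  p_le : ∀ ℓ, N.p ℓ ≤ 1
  ρ_pos : ∀ ℓ ∈ N.users .aoi, 0 < N.ρ ℓ
  ρ_nonneg : ∀ ℓ ∈ N.users .lat, 0 ≤ N.ρ ℓ
  α_pos : ∀ ℓ ∈ N.users .thr, 0 < N.α ℓ
  q_thr : ∀ ℓ ∈ N.users .thr, N.q ℓ = 1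
  ζ_pos : 0 < N.ζ

/-! ### The convex program for the target inter-arrival times -/

/-- Feasible points of the convex program. -/
def TargetFeasible (T : I → ℝ) : Prop :=
  ∑ ℓ ∈ N.users .aoi, 1 / (N.p ℓ * T ℓ) ≤ N.ζ ∧ ∀ ℓ ∈ N.users .aoi, 1 ≤ T ℓ

/-- Objective of the convex program. -/
def targetObjective (T : I → ℝ) : ℝ :=
  ∑ ℓ ∈ N.users .aoi, N.ρ ℓ / 2 * (T ℓ + (1 - N.q ℓ) / N.q ℓ ^ 2 / T ℓ)

/-- `T` solves the convex program. -/
def IsTarget (T : I → ℝ) : Prop :=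
  N.TargetFeasible T ∧ ∀ T', N.TargetFeasible T' → N.targetObjective T ≤ N.targetObjective T'

/-! ### The hierarchical index policy, run with target inter-arrival times `T` -/

/-- The threshold of the counter of user `ℓ`. -/
def threshold (T : I → ℝ) (ℓ : I) : ℤ := ⌈T ℓ - 1 / N.q ℓ⌉

/-- The latest slot, until slot `t`, in which the counter of user `ℓ` was incremented (`0` if there
is none). The counter is incremented in a slot when a packet arrives and the time since
the last increment exceeds the threshold. -/
def lastIncrement (T : I → ℝ) (r : Run I) (ℓ : I) : ℕ → ℕ
  | 0 => 0
  | t + 1 =>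
    if r.arr (t + 1) ℓ = true ∧
        N.threshold T ℓ < ((t + 1 : ℕ) : ℤ) - (lastIncrement T r ℓ t : ℤ) then t + 1
    else lastIncrement T r ℓ t

/-- The slots until slot `t` in which the counter of user `ℓ` was incremented. These are also the
packets (identified with their arrival slots) that arrive at the increments of the counter. -/
def selected (T : I → ℝ) (r : Run I) (ℓ : I) (t : ℕ) : Finset ℕ :=
  (Finset.Icc 1 t).filter fun s =>
    r.arr s ℓ = true ∧ N.threshold T ℓ < (s : ℤ) - (N.lastIncrement T r ℓ (s - 1) : ℤ)

/-- The counter of user `ℓ` after the update of slot `t`. -/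
def counter (T : I → ℝ) (r : Run I) (ℓ : I) (t : ℕ) : ℕ := (N.selected T r ℓ t).card

/-- Update, in slot `t`, of the high priority packet `prev` of an AoI user: a packet that arrives
while the counter exceeds the number of received packets replaces it. -/
def refresh (T : I → ℝ) (r : Run I) (ℓ : I) (t : ℕ) (prev : Option ℕ) : Option ℕ :=
  if r.arr t ℓ = true ∧ (r.delivered ℓ (t - 1)).card < N.counter T r ℓ t then some t else prev

/-- The high priority packet of the AoI user `ℓ` at the end of slot `t`. -/
def held (T : I → ℝ) (r : Run I) (ℓ : I) : ℕ → Option ℕ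
  | 0 => none
  | t + 1 =>
    if (r.tx (t + 1)).map Prod.fst = some ℓ ∧ r.ok (t + 1) = true then none
    else N.refresh T r ℓ (t + 1) (held T r ℓ t)

/-- The latest packet of user `ℓ` that has arrived until slot `t` and has not been received until
slot `t - 1`. -/
def latestPending (r : Run I) (ℓ : I) (t : ℕ) : Option ℕ :=
  if h : (r.arrived ℓ t \ r.delivered ℓ (t - 1)).Nonempty then some (Finset.max' _ h) else none

/-- The latest high priority packet of user `ℓ` when the transmission of slot `t` is decided. -/
def priorityPacket (T : I → ℝ) (r : Run I) (ℓ : I) (t : ℕ) : Option ℕ :=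
  match N.kind ℓ with
  | .aoi => N.refresh T r ℓ t (N.held T r ℓ (t - 1))
  | .lat => latestPending r ℓ t
  | .thr => none

/-- The index of user `ℓ` when the transmission of slot `t` is decided: `0` if there is no high
priority packet; otherwise `ρ p / q` for a latency user, and for an AoI user the value `ρ p (g - λ)`
assigned in the slot `g` in which the high priority packet arrived. -/
def index (T : I → ℝ) (r : Run I) (ℓ : I) (t : ℕ) : ℝ :=
  match N.priorityPacket T r ℓ t with
  | none => 0
  | some g =>
    match N.kind ℓ with
    | .aoi => N.ρ ℓ * N.p ℓ * r.age ℓ g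
    | .lat => N.ρ ℓ * N.p ℓ / N.q ℓ
    | .thr => 0

/-- The index by which throughput users are compared in slot `t`. -/
def deficit (r : Run I) (k : I) (t : ℕ) : ℝ :=
  N.α k * (t : ℝ) / N.p k - (r.attempts k (t - 1) : ℝ)

/-- The transmission rule of the hierarchical index policy in slot `t`. Ties are broken arbitrarily,
and so is the choice among the packets of a throughput user. -/
def Rule (T : I → ℝ) (r : Run I) (t : ℕ) : Prop :=
  ((∃ ℓ, 0 < N.index T r ℓ t) →
    ∃ ℓ g, (∀ ℓ', N.index T r ℓ' t ≤ N.index T r ℓ t) ∧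
      N.priorityPacket T r ℓ t = some g ∧ r.tx t = some (ℓ, g)) ∧
  ((¬ ∃ ℓ, 0 < N.index T r ℓ t) → (N.users .thr).Nonempty →
    ∃ k ∈ N.users .thr, ∃ g, (∀ k' ∈ N.users .thr, N.deficit r k' t ≤ N.deficit r k t) ∧
      r.tx t = some (k, g)) ∧
  ((¬ ∃ ℓ, 0 < N.index T r ℓ t) → ¬ (N.users .thr).Nonempty → r.tx t = none)

/-- `π` is a hierarchical index policy with target inter-arrival times `T`. Only sample paths in
which a packet arrives in every slot for every throughput user matter (their arrival probability
is `1`). -/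
def IsHierarchical (T : I → ℝ) (π : Policy I) : Prop :=
  ∀ u arr ch, (∀ t, ∀ k ∈ N.users .thr, arr t k = true) →
    ∀ t : ℕ, 1 ≤ t → N.Rule T (π.run u arr ch) t

/-! ### The cost -/

/-- `F₁` evaluated at average inter-arrival times `m` and empirical variances `v`. -/
def F1At (m v : I → ℝ) : ℝ := ∑ ℓ ∈ N.users .aoi, N.ρ ℓ / 2 * (m ℓ + v ℓ / m ℓ + 1)

/-- The AoI part `F₁` of the cost, computed from the packets `D ℓ t`: the value `F1At m v` at the
long-run averages `m` and `v`, which are unique if they exist, and `⊤` if they do not exist. -/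
def F1 (D : I → ℕ → Finset ℕ) : EReal :=
  sInf {x : EReal | ∃ m v : I → ℝ,
    (∀ ℓ ∈ N.users .aoi, HasMeanGap (D ℓ) (m ℓ) ∧ HasGapVariance (D ℓ) (m ℓ) (v ℓ)) ∧
      x = ((N.F1At m v : ℝ) : EReal)}

/-- The explicit bound on `F₁`. -/
def F1Bound (T : I → ℝ) : ℝ :=
  ∑ ℓ ∈ N.users .aoi, N.ρ ℓ / 2 * ((T ℓ + 1) + (1 - N.q ℓ) / N.q ℓ ^ 2 / T ℓ + 1)

/-! ### The probabilistic model -/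

/-- `arr t ℓ`, `ch ℓ t` and `U` are the random arrivals, channel states and randomization seed: all
these are independent, `arr t ℓ` is Bernoulli with parameter `q ℓ`, `ch ℓ t` is Bernoulli with
parameter `p ℓ`, and `U` is uniform on `[0, 1]`. -/
structure IsModel {Ω : Type*} [MeasurableSpace Ω] (P : Measure Ω)
    (arr : ℕ → I → Ω → Bool) (ch : I → ℕ → Ω → Bool) (U : Ω → ℝ) : Prop where
  measurable_arr : ∀ t ℓ, Measurable (arr t ℓ)
  measurable_ch : ∀ ℓ t, Measurable (ch ℓ t)
  measurable_seed : Measurable U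
  arr_law : ∀ t ℓ, P {ω | arr t ℓ ω = true} = ENNReal.ofReal (N.q ℓ)
  ch_law : ∀ ℓ t, P {ω | ch ℓ t ω = true} = ENNReal.ofReal (N.p ℓ)
  seed_law : P.map U = volume.restrict (Set.Icc (0 : ℝ) 1)
  indep_coins : iIndepFun
    (Sum.elim (fun x : ℕ × I => arr x.1 x.2) (fun x : I × ℕ => ch x.1 x.2)) P
  indep_seed : IndepFun U
    (fun ω => ((fun x : ℕ × I => arr x.1 x.2 ω), (fun x : I × ℕ => ch x.1 x.2 ω))) P

/-- The random sample path of a policy. -/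
def path {Ω : Type*} (arr : ℕ → I → Ω → Bool) (ch : I → ℕ → Ω → Bool) (U : Ω → ℝ)
    (π : Policy I) (ω : Ω) : Run I :=
  π.run (U ω) (fun t ℓ => arr t ℓ ω) (fun ℓ t => ch ℓ t ω)

/-- Feasible policies: almost surely, the long-run average ages of the AoI users and the long-run
average latencies of the latency users exist and are finite, and each throughput user `k` has a
long-run throughput of at least `α k`. -/
def Feasible {Ω : Type*} [MeasurableSpace Ω] (P : Measure Ω)
    (arr : ℕ → I → Ω → Bool) (ch : I → ℕ → Ω → Bool) (U : Ω → ℝ) (π : Policy I) : Prop :=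
  ∀ᵐ ω ∂P,
    (∀ i ∈ N.users .aoi, ∃ A : ℝ,
      Tendsto (fun t => (path arr ch U π ω).avgAge i t) atTop (𝓝 A)) ∧
    (∀ j ∈ N.users .lat, ∃ L : ℝ,
      Tendsto (fun t => (path arr ch U π ω).avgLatency j t) atTop (𝓝 L)) ∧
    (∀ k ∈ N.users .thr, ∃ R : ℝ, N.α k ≤ R ∧
      Tendsto (fun t => (path arr ch U π ω).throughput k t) atTop (𝓝 R))

/-- The infimum of `F₁` over the feasible causal policies. (Where the limits that define `F₁` are
random, the essential infimum over the sample space is taken.) -/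
def minF1 {Ω : Type*} [MeasurableSpace Ω] (P : Measure Ω)
    (arr : ℕ → I → Ω → Bool) (ch : I → ℕ → Ω → Bool) (U : Ω → ℝ) : EReal :=
  ⨅ π ∈ {π : Policy I | N.Feasible P arr ch U π},
    essInf (fun ω => N.F1 (path arr ch U π ω).delivered) P

end Network

end Downlink

end

/-!
The selected packets of an AoI user form a renewal process: with the threshold `θ = ⌈T - 1 / q⌉`, the
gap between two of them is `θ` plus a geometric random variable with parameter `q`. At the optimum of
the convex program `T > 1 / q - 1` (`IsTarget.lt`), so that `θ ≥ 0`, and the mean gap `θ + 1 / q` lies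
in `[T, T + 1)`. The variance of the gaps is that of the geometric variable.

The limits are not derived from the independence of the gaps but slot by slot. Let the excess of a
slot be the amount by which the time since the last renewal exceeds `θ`. The number of renewals minus
`q` times the number of slots with positive excess, and the sum of the excesses at renewals minus `q`
times the sum of all excesses, are martingales with orthogonal increments that are bounded in `L²`;
both are negligible by Chebyshev's argument along the squares (`ae_tendsto_avg_sq`), which passes to
all times by monotonicity. Together with combinatorial identities within the cycles (`sum_active`,
`sum_renewal_excess`, `sum_two_mul_excess`) this determines the first two moments of the gaps.

Under the hierarchical policy an admitted packet replaces all older ones for good. Hence, if all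
selected packets are received, no other packet can be received, and each selected packet is received
before the next one arrives: the received packets are always an initial segment of the selected ones
(`delivered_eq_selected`) and have the same limits.

For the lower bound consider a feasible policy. A convergent average age forces the latest received
packet to be recent, so that packets are received at rate `1 / m`, where `m` is the average gap, and
`m ≥ 1 / q` because the received packets are some of those that arrived. A convergent average latency
forces the rate of reception to be the arrival rate. Each reception by a user costs `1 / p` slots on
average (`ae_tendsto_attempts`), so the rates satisfy the capacity constraint, and the average gaps
are feasible for the convex program (`ae_targetFeasible`). So the target is no worse than `m`. Finally
`(1 - q) / q ^ 2 / m ≤ 1 / q - 1 ≤ m - 1`, so the factor `2` absorbs both the rounding of the threshold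
and the variance term, whatever the variance of the policy is (`F1Bound_add_le`).
-/

noncomputable section

namespace Downlink

/-! ### Strong laws of large numbers for orthogonal sequences -/

section LargeNumbers

variable {Ω : Type*} [MeasurableSpace Ω] {P : Measure Ω}

lemma integral_sq_sum_le {d : ℕ → Ω → ℝ} (hd : ∀ i, MemLp (d i) 2 P)
    (horth : ∀ i j, i < j → ∫ ω, d i ω * d j ω ∂P = 0) {C : ℝ}
    (hC : ∀ i, ∫ ω, d i ω ^ 2 ∂P ≤ C) (n : ℕ) :
    ∫ ω, (∑ i ∈ Finset.range n, d i ω) ^ 2 ∂P ≤ C * n := by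
  induction n with
  | zero => simp
  | succ n ih =>
    have hS : MemLp (fun ω => ∑ i ∈ Finset.range n, d i ω) 2 P :=
      memLp_finsetSum _ fun i _ => hd i
    have hcross : ∫ ω, (∑ i ∈ Finset.range n, d i ω) * d n ω ∂P = 0 := by
      simp only [Finset.sum_mul]
      rw [integral_finsetSum _ fun i _ => show Integrable (fun ω => d i ω * d n ω) P from
        (hd i).integrable_mul (hd n)]
      exact Finset.sum_eq_zero fun i hi => horth i n (Finset.mem_range.1 hi)
    have hexp : ∀ ω, (∑ i ∈ Finset.range (n + 1), d i ω) ^ 2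
        = (∑ i ∈ Finset.range n, d i ω) ^ 2
          + 2 * ((∑ i ∈ Finset.range n, d i ω) * d n ω) + d n ω ^ 2 := by
      intro ω
      rw [Finset.sum_range_succ]
      ring
    have hint : Integrable (fun ω => (∑ i ∈ Finset.range n, d i ω) * d n ω) P :=
      hS.integrable_mul (hd n)
    simp only [hexp]
    have h12 : Integrable (fun ω => (∑ i ∈ Finset.range n, d i ω) ^ 2
        + 2 * ((∑ i ∈ Finset.range n, d i ω) * d n ω)) P :=
      hS.integrable_sq.add (hint.const_mul 2)
    rw [integral_add h12 (hd n).integrable_sq, integral_add hS.integrable_sq (hint.const_mul 2),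
      integral_const_mul, hcross]
    have := hC n
    push_cast
    linarith

/-- Strong law along the squares for orthogonal sequences that are bounded in `L²`: the second
moments of the averages are summable along the squares. -/
lemma ae_tendsto_avg_sq {d : ℕ → Ω → ℝ} (hd : ∀ i, MemLp (d i) 2 P)
    (horth : ∀ i j, i < j → ∫ ω, d i ω * d j ω ∂P = 0) {C : ℝ}
    (hC : ∀ i, ∫ ω, d i ω ^ 2 ∂P ≤ C) :
    ∀ᵐ ω ∂P, Tendsto (fun k : ℕ => (∑ i ∈ Finset.range (k ^ 2), d i ω) / ((k ^ 2 : ℕ) : ℝ))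
      atTop (𝓝 0) := by
  set f : ℕ → Ω → ℝ := fun k ω => (∑ i ∈ Finset.range (k ^ 2), d i ω) / ((k ^ 2 : ℕ) : ℝ)
  have hS : ∀ k, MemLp (f k) 2 P := fun k => by
    have : MemLp (fun ω => ∑ i ∈ Finset.range (k ^ 2), d i ω) 2 P :=
      memLp_finsetSum _ fun i _ => hd i
    simpa [f, div_eq_mul_inv] using this.mul_const _
  have hle : ∀ k, ∫ ω, f k ω ^ 2 ∂P ≤ C * (1 / (k : ℝ) ^ 2) := by
    intro k
    rcases Nat.eq_zero_or_pos k with rfl | hk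
    · simp [f]
    have hk' : (0 : ℝ) < k := by exact_mod_cast hk
    have := integral_sq_sum_le hd horth hC (k ^ 2)
    simp only [f, div_pow, integral_div]
    rw [div_le_iff₀ (by positivity)]
    refine this.trans (le_of_eq ?_)
    push_cast
    field_simp
  have hsum : ∑' k, ∫⁻ ω, ENNReal.ofReal (f k ω ^ 2) ∂P ≠ ⊤ := by
    have hs : Summable fun k : ℕ => C * (1 / (k : ℝ) ^ 2) :=
      (Real.summable_one_div_nat_pow.2 (by norm_num)).mul_left C
    refine ne_top_of_le_ne_top hs.tsum_ofReal_ne_top (ENNReal.tsum_le_tsum fun k => ?_)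
    rw [← ofReal_integral_eq_lintegral_ofReal (hS k).integrable_sq
      (Eventually.of_forall fun ω => sq_nonneg _)]
    exact ENNReal.ofReal_le_ofReal (hle k)
  rw [← lintegral_tsum fun k => ((hS k).integrable_sq.aemeasurable.ennreal_ofReal)] at hsum
  filter_upwards [ae_lt_top' (AEMeasurable.tsum
    fun k => ((hS k).integrable_sq.aemeasurable.ennreal_ofReal)) hsum] with ω hω
  have h0 := ENNReal.tendsto_atTop_zero_of_tsum_ne_top hω.ne
  have h1 : Tendsto (fun k => f k ω ^ 2) atTop (𝓝 0) := by
    have := (ENNReal.tendsto_toReal ENNReal.zero_ne_top).comp h0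
    simpa [Function.comp_def, ENNReal.toReal_ofReal (sq_nonneg _)] using this
  have h2 := h1.sqrt
  simp only [Real.sqrt_sq_eq_abs, Real.sqrt_zero] at h2
  exact (tendsto_zero_iff_abs_tendsto_zero _).2 h2

/-- Averages of a monotone sequence converge if they do so along the squares. -/
lemma tendsto_div_of_monotone_of_sq {u : ℕ → ℝ} {l : ℝ} (hu : Monotone u)
    (h : Tendsto (fun k : ℕ => u (k ^ 2) / ((k ^ 2 : ℕ) : ℝ)) atTop (𝓝 l)) :
    Tendsto (fun n => u n / n) atTop (𝓝 l) := by
  refine tendsto_div_of_monotone_of_exists_subseq_tendsto_div u l hu fun a ha =>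
    ⟨fun k => k ^ 2, ?_, tendsto_pow_atTop (by norm_num), h⟩
  have hlim : Tendsto (fun k : ℕ => ((1 : ℝ) + 1 / (k : ℝ)) ^ 2) atTop (𝓝 1) := by
    simpa using (tendsto_const_nhds (x := (1 : ℝ))).add tendsto_one_div_atTop_nhds_zero_nat |>.pow 2
  filter_upwards [hlim.eventually (gt_mem_nhds ha), eventually_gt_atTop 0] with k hk hk0
  have hk' : (0 : ℝ) < k := by exact_mod_cast hk0
  have : (((k + 1) ^ 2 : ℕ) : ℝ) = (1 + 1 / (k : ℝ)) ^ 2 * ((k ^ 2 : ℕ) : ℝ) := by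
    push_cast
    field_simp
  rw [this]
  gcongr

/-- Strong law of large numbers for bounded orthogonal sequences. -/
lemma ae_tendsto_avg_of_bounded [IsProbabilityMeasure P] {d : ℕ → Ω → ℝ}
    (hmeas : ∀ i, Measurable (d i)) (hb : ∀ i ω, |d i ω| ≤ 1)
    (horth : ∀ i j, i < j → ∫ ω, d i ω * d j ω ∂P = 0) :
    ∀ᵐ ω ∂P, Tendsto (fun n : ℕ => (∑ i ∈ Finset.range n, d i ω) / (n : ℝ)) atTop (𝓝 0) := by
  have hd : ∀ i, MemLp (d i) 2 P := fun i =>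
    MemLp.of_bound (hmeas i).aestronglyMeasurable 1 (Eventually.of_forall fun ω => hb i ω)
  have hC : ∀ i, ∫ ω, d i ω ^ 2 ∂P ≤ 1 := fun i => by
    have h := integral_mono (μ := P) (hd i).integrable_sq (integrable_const (1 : ℝ))
      (fun ω => (sq_le_one_iff_abs_le_one _).2 (hb i ω))
    simpa using h
  filter_upwards [ae_tendsto_avg_sq hd horth hC] with ω hω
  -- adding `1` to each term makes the partial sums monotone
  have hmono : Monotone fun n : ℕ => (∑ i ∈ Finset.range n, d i ω) + n := by
    refine monotone_nat_of_le_succ fun n => ?_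
    have := (abs_le.1 (hb n ω)).1
    rw [Finset.sum_range_succ]
    push_cast
    linarith
  have h1 := tendsto_div_of_monotone_of_sq (l := 1) hmono (by
    refine Tendsto.congr' ?_ ((hω.add_const 1).trans (by simp))
    filter_upwards [eventually_gt_atTop 0] with k hk
    have : ((k ^ 2 : ℕ) : ℝ) ≠ 0 := by positivity
    rw [add_div, div_self this])
  refine Tendsto.congr' ?_ ((h1.sub_const 1).trans (by simp))
  filter_upwards [eventually_gt_atTop 0] with n hn
  have : (n : ℝ) ≠ 0 := by positivity
  rw [add_div, div_self this, add_sub_cancel_right]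

end LargeNumbers

/-! ### Renewals on a single sample path -/

section Renewal

/-- The last renewal up to time `t`, when coin `i` is tossed in slot `i + 1`, and a renewal occurs
in a slot if its coin is `true` and more than `θ` slots have passed since the last renewal. -/
def lastRenewal (θ : ℕ) (b : ℕ → Bool) : ℕ → ℕ
  | 0 => 0
  | t + 1 => if b t = true ∧ θ < t + 1 - lastRenewal θ b t then t + 1 else lastRenewal θ b t

/-- By how much the time since the last renewal exceeds `θ` in slot `t + 1` (`0` if it does not). -/
def excess (θ : ℕ) (b : ℕ → Bool) (t : ℕ) : ℕ := t + 1 - lastRenewal θ b t - θ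

/-- A coin as a real number. -/
def coin (c : Bool) : ℝ := if c = true then 1 else 0

/-- Indicator of a positive excess, i.e. of a slot in which a renewal is possible. -/
def active (θ : ℕ) (b : ℕ → Bool) (t : ℕ) : ℝ := if 0 < excess θ b t then 1 else 0

/-- Number of renewals up to time `t`. -/
def renewals (θ : ℕ) (b : ℕ → Bool) (t : ℕ) : ℝ :=
  ∑ i ∈ Finset.range t, active θ b i * coin (b i)

variable {θ : ℕ} {b : ℕ → Bool}

lemma coin_nonneg (c : Bool) : 0 ≤ coin c := by unfold coin; split_ifs <;> norm_num

lemma coin_le_one (c : Bool) : coin c ≤ 1 := by unfold coin; split_ifs <;> norm_num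

lemma active_nonneg (θ : ℕ) (b : ℕ → Bool) (t : ℕ) : 0 ≤ active θ b t := by
  unfold active; split_ifs <;> norm_num

lemma active_le_one (θ : ℕ) (b : ℕ → Bool) (t : ℕ) : active θ b t ≤ 1 := by
  unfold active; split_ifs <;> norm_num

lemma lastRenewal_le (t : ℕ) : lastRenewal θ b t ≤ t := by
  induction t with
  | zero => simp [lastRenewal]
  | succ t ih => rw [lastRenewal]; split_ifs <;> omega

lemma lastRenewal_succ (t : ℕ) : (b t = true ∧ 0 < excess θ b t ∧
      lastRenewal θ b (t + 1) = t + 1 ∧ active θ b t * coin (b t) = 1) ∨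
    (¬ (b t = true ∧ 0 < excess θ b t) ∧
      lastRenewal θ b (t + 1) = lastRenewal θ b t ∧ active θ b t * coin (b t) = 0) := by
  by_cases h : b t = true ∧ 0 < excess θ b t
  · left
    have h' : θ < t + 1 - lastRenewal θ b t := by have := h.2; unfold excess at this; omega
    refine ⟨h.1, h.2, ?_, ?_⟩
    · rw [lastRenewal, if_pos ⟨h.1, h'⟩]
    · simp [active, coin, h.1, h.2]
  · right
    refine ⟨h, ?_, ?_⟩
    · rw [lastRenewal, if_neg]
      rintro ⟨h1, h2⟩
      exact h ⟨h1, by unfold excess; omega⟩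
    · rw [not_and_or] at h
      rcases h with h | h <;> simp [active, coin, h]

/-- Sums over renewals do not change after the last renewal. -/
lemma sum_lastRenewal (f : ℕ → ℝ) (t : ℕ) :
    ∑ i ∈ Finset.range (lastRenewal θ b t), active θ b i * coin (b i) * f i
      = ∑ i ∈ Finset.range t, active θ b i * coin (b i) * f i := by
  induction t with
  | zero => simp [lastRenewal]
  | succ t ih =>
    rcases lastRenewal_succ (θ := θ) (b := b) t with ⟨-, -, h, -⟩ | ⟨-, h, h0⟩
    · rw [h]
    · rw [h, ih, Finset.sum_range_succ, h0]; ring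

lemma lastRenewal_lastRenewal (t : ℕ) :
    lastRenewal θ b (lastRenewal θ b t) = lastRenewal θ b t := by
  induction t with
  | zero => simp [lastRenewal]
  | succ t ih =>
    rcases lastRenewal_succ (θ := θ) (b := b) t with ⟨-, -, h, -⟩ | ⟨-, h, h0⟩
    · rw [h, h]
    · rw [h, ih]

lemma renewals_lastRenewal (t : ℕ) : renewals θ b (lastRenewal θ b t) = renewals θ b t := by
  simpa [renewals] using sum_lastRenewal (θ := θ) (b := b) (fun _ => 1) t

lemma renewals_le_lastRenewal (t : ℕ) : renewals θ b t ≤ lastRenewal θ b t := by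
  rw [← renewals_lastRenewal]
  refine (Finset.sum_le_sum (g := fun _ => (1 : ℝ)) fun i _ => ?_).trans (by simp)
  exact mul_le_one₀ (active_le_one _ _ _) (coin_nonneg _) (coin_le_one _)

/-- Each cycle begins with `θ` inactive slots. -/
lemma sum_active (t : ℕ) : ∑ i ∈ Finset.range t, active θ b i
    = t - θ * renewals θ b t - (min (t - lastRenewal θ b t) θ : ℕ) := by
  induction t with
  | zero => simp [renewals, lastRenewal]
  | succ t ih =>
    have hle := lastRenewal_le (θ := θ) (b := b) t
    have hr : renewals θ b (t + 1) = renewals θ b t + active θ b t * coin (b t) :=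
      Finset.sum_range_succ _ _
    rw [Finset.sum_range_succ, ih, hr]
    rcases lastRenewal_succ (θ := θ) (b := b) t with ⟨-, h2, h, h1⟩ | ⟨-, h, h0⟩
    · rw [h1, h, active, if_pos h2, min_eq_right (by unfold excess at h2; omega)]
      simp; ring
    · rw [h0, h, active]
      split_ifs with h2
      · unfold excess at h2
        rw [min_eq_right (by omega), min_eq_right (by omega)]
        push_cast; ring
      · unfold excess at h2
        rw [min_eq_left (by omega), min_eq_left (by omega)]
        have : t + 1 - lastRenewal θ b t = (t - lastRenewal θ b t) + 1 := by omega
        rw [this]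
        push_cast; ring

lemma active_mul_excess (t : ℕ) : active θ b t * excess θ b t = excess θ b t := by
  unfold active
  split_ifs with h
  · simp
  · have : excess θ b t = 0 := by omega
    simp [this]

/-- At a renewal the excess is the length of the completed cycle minus `θ`. -/
lemma sum_renewal_excess (t : ℕ) :
    ∑ i ∈ Finset.range t, active θ b i * coin (b i) * excess θ b i
      = lastRenewal θ b t - θ * renewals θ b t := by
  induction t with
  | zero => simp [renewals, lastRenewal]
  | succ t ih =>
    have hle := lastRenewal_le (θ := θ) (b := b) t
    have hr : renewals θ b (t + 1) = renewals θ b t + active θ b t * coin (b t) :=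
      Finset.sum_range_succ _ _
    rw [Finset.sum_range_succ, ih, hr]
    rcases lastRenewal_succ (θ := θ) (b := b) t with ⟨-, h2, h, h1⟩ | ⟨-, h, h0⟩
    · rw [h1, h]
      have : (excess θ b t : ℝ) = (t + 1 : ℕ) - lastRenewal θ b t - θ := by
        unfold excess at h2 ⊢
        rw [Nat.cast_sub (by omega), Nat.cast_sub (by omega)]
      rw [this]; ring
    · rw [h0, h]; ring

/-- Within a cycle the excess runs through `1, 2, …, Y`, and `∑ (2 y - 1) = Y ^ 2`. -/
lemma sum_two_mul_excess (t : ℕ) :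
    ∑ i ∈ Finset.range t, (2 * (excess θ b i : ℝ) - active θ b i)
      = ∑ i ∈ Finset.range t, active θ b i * coin (b i) * (excess θ b i : ℝ) ^ 2
        + ((t - lastRenewal θ b t - θ : ℕ) : ℝ) ^ 2 := by
  induction t with
  | zero => simp [lastRenewal]
  | succ t ih =>
    have hle := lastRenewal_le (θ := θ) (b := b) t
    rw [Finset.sum_range_succ, ih, Finset.sum_range_succ]
    rcases lastRenewal_succ (θ := θ) (b := b) t with ⟨-, h2, h, h1⟩ | ⟨-, h, h0⟩
    · rw [h1, h, active, if_pos h2]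
      have : excess θ b t = (t - lastRenewal θ b t - θ) + 1 := by unfold excess at h2 ⊢; omega
      rw [this]
      simp; ring
    · rw [h0, h, active]
      split_ifs with h2
      · have h3 : excess θ b t = (t - lastRenewal θ b t - θ) + 1 := by
          unfold excess at h2 ⊢; omega
        have h4 : t + 1 - lastRenewal θ b t - θ = (t - lastRenewal θ b t - θ) + 1 := by
          unfold excess at h2; omega
        rw [h3, h4]
        push_cast; ring
      · have h3 : excess θ b t = 0 := by omega
        have h4 : t + 1 - lastRenewal θ b t - θ = 0 := h3
        have h5 : t - lastRenewal θ b t - θ = 0 := by omega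
        rw [h3, h4, h5]; simp

lemma excess_succ_le (t : ℕ) :
    (excess θ b (t + 1) : ℝ) ≤ 1 + (1 - coin (b t)) * excess θ b t := by
  have hle := lastRenewal_le (θ := θ) (b := b) t
  rcases lastRenewal_succ (θ := θ) (b := b) t with ⟨h1, h2, h, -⟩ | ⟨hn, h, -⟩
  · have : excess θ b (t + 1) ≤ 1 := by unfold excess; rw [h]; omega
    have h' : (excess θ b (t + 1) : ℝ) ≤ 1 := by exact_mod_cast this
    simpa [coin, h1] using h'
  · have h3 : excess θ b (t + 1) ≤ 1 + excess θ b t := by unfold excess; rw [h]; omega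
    have h' : (excess θ b (t + 1) : ℝ) ≤ 1 + excess θ b t := by exact_mod_cast h3
    by_cases hb : b t = true
    · have h0 : excess θ b t = 0 := by
        by_contra h0
        exact hn ⟨hb, by omega⟩
      simpa [coin, hb, h0] using h'
    · simpa [coin, hb] using h'

lemma excess_le (t : ℕ) : excess θ b t ≤ t + 1 := by unfold excess; omega

end Renewal

section RenewalLimits

variable {θ : ℕ} {b : ℕ → Bool} {q : ℝ}

/-- The elementary renewal theorem for one sample path, from the law of large numbers for the
compensated number of renewals: of the first `n` slots all but about `θ` per renewal are active. -/
lemma tendsto_renewals (hq : 0 < q)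
    (h1 : Tendsto (fun n : ℕ => (∑ i ∈ Finset.range n, active θ b i * (coin (b i) - q)) / (n : ℝ))
      atTop (𝓝 0)) :
    Tendsto (fun n : ℕ => renewals θ b n / n) atTop (𝓝 (1 / (θ + 1 / q))) := by
  have hpos : 0 < 1 + q * θ := by positivity
  have hmin : Tendsto (fun n : ℕ => ((min (n - lastRenewal θ b n) θ : ℕ) : ℝ) / n) atTop (𝓝 0) := by
    refine squeeze_zero (fun n => by positivity) (fun n => ?_)
      (tendsto_const_div_atTop_nhds_zero_nat (θ : ℝ))
    gcongr
    exact min_le_right _ _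
  have h2 := ((h1.add_const q).sub (hmin.const_mul q)).div_const (1 + q * θ)
  refine Tendsto.congr' ?_ (h2.trans (le_of_eq ?_))
  · filter_upwards [eventually_gt_atTop 0] with n hn
    have hn' : (n : ℝ) ≠ 0 := by positivity
    have : ∑ i ∈ Finset.range n, active θ b i * (coin (b i) - q)
        = renewals θ b n - q * (n - θ * renewals θ b n - (min (n - lastRenewal θ b n) θ : ℕ)) := by
      rw [← sum_active, renewals, Finset.mul_sum, ← Finset.sum_sub_distrib]
      exact Finset.sum_congr rfl fun i _ => by ring
    rw [this]
    field_simp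
    ring
  · congr 1
    field_simp
    ring

lemma tendsto_lastRenewal (hq : 0 < q)
    (h1 : Tendsto (fun n : ℕ => (∑ i ∈ Finset.range n, active θ b i * (coin (b i) - q)) / (n : ℝ))
      atTop (𝓝 0)) : Tendsto (lastRenewal θ b) atTop atTop := by
  have hr := tendsto_renewals hq h1
  have h2 : Tendsto (fun n : ℕ => renewals θ b n / n * n) atTop atTop :=
    hr.pos_mul_atTop (by positivity) tendsto_natCast_atTop_atTop
  rw [← tendsto_natCast_atTop_iff (R := ℝ)]
  refine tendsto_atTop_mono' _ ?_ h2
  filter_upwards [eventually_gt_atTop 0] with n hn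
  have hn' : (n : ℝ) ≠ 0 := by positivity
  rw [div_mul_cancel₀ _ hn']
  exact renewals_le_lastRenewal n

/-- The mean cycle length is `θ + 1 / q`. -/
lemma tendsto_lastRenewal_div_renewals (hq : 0 < q)
    (h1 : Tendsto (fun n : ℕ => (∑ i ∈ Finset.range n, active θ b i * (coin (b i) - q)) / (n : ℝ))
      atTop (𝓝 0)) :
    Tendsto (fun n : ℕ => (lastRenewal θ b n : ℝ) / renewals θ b n) atTop (𝓝 (θ + 1 / q)) := by
  have h := ((tendsto_renewals hq h1).comp (tendsto_lastRenewal hq h1)).inv₀ (by positivity)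
  simpa [Function.comp_def, renewals_lastRenewal] using h

/-- The empirical variance of the cycle lengths tends to that of a geometric random variable. -/
lemma tendsto_renewal_variance (hq : 0 < q)
    (h1 : Tendsto (fun n : ℕ => (∑ i ∈ Finset.range n, active θ b i * (coin (b i) - q)) / (n : ℝ))
      atTop (𝓝 0))
    (h2 : Tendsto (fun k : ℕ => (∑ i ∈ Finset.range (k ^ 2), excess θ b i * (coin (b i) - q)) /
      ((k ^ 2 : ℕ) : ℝ)) atTop (𝓝 0)) :
    Tendsto (fun n : ℕ => (∑ i ∈ Finset.range n,
      active θ b i * coin (b i) * ((excess θ b i : ℝ) - 1 / q) ^ 2) / renewals θ b n) atTop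
      (𝓝 ((1 - q) / q ^ 2)) := by
  have hm : (0 : ℝ) < θ + 1 / q := by positivity
  set r : ℝ := 1 / (θ + 1 / q) with hr
  have hr0 : 0 < r := by positivity
  have hN := tendsto_renewals hq h1
  have hL := tendsto_lastRenewal hq h1
  have hLN := tendsto_lastRenewal_div_renewals hq h1
  rw [← hr] at hN
  have hNpos : ∀ᶠ n in atTop, 0 < renewals θ b n := by
    filter_upwards [hN.eventually (lt_mem_nhds hr0), eventually_gt_atTop 0] with n hn hn0
    have : (0 : ℝ) < n := by positivity
    exact (div_pos_iff_of_pos_right this).1 hn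
  -- the sum of the excesses at the renewals
  have hA : Tendsto (fun n : ℕ => (∑ i ∈ Finset.range n,
      active θ b i * coin (b i) * excess θ b i) / n) atTop (𝓝 (r / q)) := by
    have h3 := (hLN.mul hN).sub (hN.const_mul (θ : ℝ))
    refine Tendsto.congr' ?_ (h3.trans (le_of_eq ?_))
    · filter_upwards [hNpos, eventually_gt_atTop 0] with n hn hn0
      have hn' : (n : ℝ) ≠ 0 := by positivity
      rw [sum_renewal_excess]
      field_simp
    · congr 1
      rw [hr]
      field_simp
      ring
  -- the sum of all excesses, first along the squares
  have hB : Tendsto (fun n : ℕ => (∑ i ∈ Finset.range n, (excess θ b i : ℝ)) / n) atTop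
      (𝓝 (r / q ^ 2)) := by
    refine tendsto_div_of_monotone_of_sq ?_ ?_
    · exact monotone_nat_of_le_succ fun n => by
        rw [Finset.sum_range_succ]
        have : (0 : ℝ) ≤ excess θ b n := by positivity
        linarith
    · have h3 := ((hA.comp (tendsto_pow_atTop (α := ℕ) (n := 2) (by norm_num))).sub h2).div_const q
      refine Tendsto.congr (fun k => ?_) (h3.trans (le_of_eq ?_))
      · simp only [Function.comp_def]
        rw [← sub_div, ← Finset.sum_sub_distrib, div_div, mul_comm, ← div_div, Finset.sum_div]
        congr 1
        refine Finset.sum_congr rfl fun i _ => ?_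
        have := active_mul_excess (θ := θ) (b := b) i
        rw [show active θ b i * coin (b i) * (excess θ b i : ℝ)
          = coin (b i) * (active θ b i * excess θ b i) by ring, this]
        field_simp
        ring
      · congr 1
        field_simp
        ring
  have hE : Tendsto (fun n : ℕ => (∑ i ∈ Finset.range n, active θ b i) / (n : ℝ)) atTop
      (𝓝 (r / q)) := by
    have h3 := (hN.sub h1).div_const q
    refine Tendsto.congr (fun n => ?_) (h3.trans (by simp))
    rw [← sub_div, renewals, ← Finset.sum_sub_distrib, div_div, mul_comm, ← div_div,
      Finset.sum_div]
    congr 1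
    refine Finset.sum_congr rfl fun i _ => ?_
    field_simp
    ring
  -- the squares of the excesses at the renewals, evaluated at the end of the last cycle
  have hQ : Tendsto (fun n : ℕ => (∑ i ∈ Finset.range n,
      active θ b i * coin (b i) * (excess θ b i : ℝ) ^ 2) / renewals θ b n) atTop
      (𝓝 (2 / q ^ 2 - 1 / q)) := by
    have h3 := ((hB.const_mul 2).sub hE).div hN hr0.ne'
    have h4 := h3.comp hL
    refine Tendsto.congr' ?_ (h4.trans (le_of_eq ?_))
    · filter_upwards [hL.eventually_gt_atTop 0, hNpos] with n hn hn2
      have hn' : (lastRenewal θ b n : ℝ) ≠ 0 := by positivity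
      have h5 := sum_two_mul_excess (θ := θ) (b := b) (lastRenewal θ b n)
      rw [lastRenewal_lastRenewal, sum_lastRenewal, Finset.sum_sub_distrib, ← Finset.mul_sum] at h5
      simp only [tsub_self, zero_tsub, Nat.cast_zero] at h5
      simp only [Function.comp_def, Pi.div_apply]
      rw [renewals_lastRenewal]
      have : ∑ i ∈ Finset.range n, active θ b i * coin (b i) * (excess θ b i : ℝ) ^ 2
        = 2 * ∑ i ∈ Finset.range (lastRenewal θ b n), (excess θ b i : ℝ)
          - ∑ i ∈ Finset.range (lastRenewal θ b n), active θ b i := by linarith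
      rw [this]
      field_simp
    · congr 1
      field_simp
  have hAN := hA.div hN hr0.ne'
  have h6 := (hQ.sub (hAN.const_mul (2 / q))).add_const (1 / q ^ 2)
  refine Tendsto.congr' ?_ (h6.trans (le_of_eq ?_))
  · filter_upwards [hNpos, eventually_gt_atTop 0] with n hn hn0
    have hn' : (n : ℝ) ≠ 0 := by positivity
    have hsplit : ∑ i ∈ Finset.range n, active θ b i * coin (b i) * ((excess θ b i : ℝ) - 1 / q) ^ 2
        = ∑ i ∈ Finset.range n, active θ b i * coin (b i) * (excess θ b i : ℝ) ^ 2
          - 2 / q * ∑ i ∈ Finset.range n, active θ b i * coin (b i) * (excess θ b i : ℝ)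
          + 1 / q ^ 2 * renewals θ b n := by
      rw [renewals, Finset.mul_sum, Finset.mul_sum, ← Finset.sum_sub_distrib,
        ← Finset.sum_add_distrib]
      exact Finset.sum_congr rfl fun i _ => by ring
    rw [hsplit]
    simp only [Pi.div_apply]
    field_simp
  · congr 1
    field_simp
    ring

end RenewalLimits

/-! ### Independence of a coin and all other sources of randomness -/

section Independence

variable {I : Type*} {Ω : Type*}

/-- All arrivals and channel states, as one family of coins. -/
def coins (arr : ℕ → I → Ω → Bool) (ch : I → ℕ → Ω → Bool) : (ℕ × I) ⊕ (I × ℕ) → Ω → Bool :=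
  Sum.elim (fun x : ℕ × I => arr x.1 x.2) (fun x : I × ℕ => ch x.1 x.2)

/-- The σ-algebras of the sources of randomness: the seed (`none`) and the coins. -/
@[reducible] def source (arr : ℕ → I → Ω → Bool) (ch : I → ℕ → Ω → Bool) (U : Ω → ℝ) :
    Option ((ℕ × I) ⊕ (I × ℕ)) → MeasurableSpace Ω
  | none => MeasurableSpace.comap U inferInstance
  | some x => MeasurableSpace.comap (coins arr ch x) inferInstance

/-- The information contained in the seed and in all coins except for `x`. -/
@[reducible] def others (arr : ℕ → I → Ω → Bool) (ch : I → ℕ → Ω → Bool) (U : Ω → ℝ)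
    (x : (ℕ × I) ⊕ (I × ℕ)) : MeasurableSpace Ω :=
  ⨆ i ∈ ({some x}ᶜ : Set (Option ((ℕ × I) ⊕ (I × ℕ)))), source arr ch U i

variable {arr : ℕ → I → Ω → Bool} {ch : I → ℕ → Ω → Bool} {U : Ω → ℝ}

lemma measurable_seed_others (x) : Measurable[others arr ch U x] U :=
  (comap_measurable U).mono (le_biSup (source arr ch U) (i := none) (by simp)) le_rfl

lemma measurable_coin_others {x y : (ℕ × I) ⊕ (I × ℕ)} (h : y ≠ x) :
    Measurable[others arr ch U x] (coins arr ch y) :=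
  (comap_measurable (coins arr ch y)).mono
    (le_biSup (source arr ch U) (i := some y) (by simpa using h)) le_rfl

variable [mΩ : MeasurableSpace Ω] {N : Network I} {P : Measure Ω}

lemma measurable_coins (hM : N.IsModel P arr ch U) (x) : Measurable (coins arr ch x) := by
  rcases x with x | x
  · exact hM.measurable_arr _ _
  · exact hM.measurable_ch _ _

lemma source_le (hM : N.IsModel P arr ch U) (i) : source arr ch U i ≤ mΩ := by
  rcases i with _ | x
  · exact hM.measurable_seed.comap_le
  · exact (measurable_coins hM x).comap_le

lemma others_le (hM : N.IsModel P arr ch U) (x) : others arr ch U x ≤ mΩ :=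
  iSup₂_le fun i _ => source_le hM i

lemma iIndep_source (hM : N.IsModel P arr ch U) : iIndep (source arr ch U) P := by
  classical
  rw [iIndep_iff]
  intro s f hf
  -- the coins are independent among each other; the seed is split off, if it is involved
  have hcoins : P (⋂ x ∈ s.eraseNone, f (some x)) = ∏ x ∈ s.eraseNone, P (f (some x)) :=
    (iIndepFun_iff _ _ _).1 hM.indep_coins s.eraseNone
      (f' := fun x => f (some x)) fun x hx => hf _ (Finset.mem_eraseNone.1 hx)
  by_cases hs : none ∈ s
  · have hs' : s = Finset.insertNone s.eraseNone := by
      rw [Finset.insertNone_eraseNone, Finset.insert_eq_of_mem hs]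
    have hU := hf none hs
    have hC : MeasurableSet[MeasurableSpace.comap (fun ω =>
        ((fun x : ℕ × I => arr x.1 x.2 ω), (fun x : I × ℕ => ch x.1 x.2 ω))) inferInstance]
        (⋂ x ∈ s.eraseNone, f (some x)) := by
      refine Finset.measurableSet_biInter _ fun x hx => ?_
      refine (?_ : source arr ch U (some x) ≤ _) _ (hf _ (Finset.mem_eraseNone.1 hx))
      rw [source, ← measurable_iff_comap_le]
      have hm := comap_measurable (m := inferInstance) (fun ω =>
        ((fun x : ℕ × I => arr x.1 x.2 ω), (fun x : I × ℕ => ch x.1 x.2 ω)))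
      rcases x with x | x
      · exact (measurable_pi_apply x).comp (measurable_fst.comp hm)
      · exact (measurable_pi_apply x).comp (measurable_snd.comp hm)
    have hind := (Indep_iff _ _ _).1 ((IndepFun_iff_Indep _ _ _).1 hM.indep_seed) _ _ hU hC
    have hinter : (⋂ i ∈ s, f i) = f none ∩ ⋂ x ∈ s.eraseNone, f (some x) := by
      ext ω
      simp only [Set.mem_iInter, Set.mem_inter_iff, Finset.mem_eraseNone]
      refine ⟨fun h => ⟨h _ hs, fun x hx => h _ hx⟩, fun h i hi => ?_⟩
      rcases i with _ | x
      exacts [h.1, h.2 x hi]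
    rw [hinter, hind, hcoins]
    conv_rhs => rw [hs', Finset.prod_insertNone]
  · have hs' : s = s.eraseNone.map Function.Embedding.some := by
      rw [Finset.map_some_eraseNone, Finset.erase_eq_of_notMem hs]
    have hinter : (⋂ i ∈ s, f i) = ⋂ x ∈ s.eraseNone, f (some x) := by
      ext ω
      simp only [Set.mem_iInter, Finset.mem_eraseNone]
      refine ⟨fun h x hx => h _ hx, fun h i hi => ?_⟩
      rcases i with _ | x
      exacts [absurd hi hs, h x hi]
    rw [hinter, hcoins]
    conv_rhs => rw [hs', Finset.prod_map]
    rfl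

lemma indep_others (hM : N.IsModel P arr ch U) (x) :
    Indep (others arr ch U x) (MeasurableSpace.comap (coins arr ch x) inferInstance) P := by
  have h := indep_iSup_of_disjoint (source_le hM) (iIndep_source hM)
    (S := ({some x}ᶜ : Set _)) (T := {some x}) disjoint_compl_left
  simpa [others, source] using h

variable [IsProbabilityMeasure P]

/-- A compensated coin is orthogonal to everything that does not depend on this coin. -/
lemma integral_mul_coin_sub (hM : N.IsModel P arr ch U) {x : (ℕ × I) ⊕ (I × ℕ)} {p : ℝ}
    (hp : 0 ≤ p) (hx : P {ω | coins arr ch x ω = true} = ENNReal.ofReal p) {f : Ω → ℝ}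
    (hf : Measurable[others arr ch U x] f) :
    ∫ ω, f ω * (coin (coins arr ch x ω) - p) ∂P = 0 := by
  have hc := measurable_coins hM x
  have hcoin : Measurable fun c : Bool => coin c - p := measurable_of_countable _
  have hind : IndepFun f (fun ω => coin (coins arr ch x ω) - p) P := by
    rw [IndepFun_iff_Indep]
    refine indep_of_indep_of_le_left (indep_of_indep_of_le_right (indep_others hM x) ?_) ?_
    · rw [← measurable_iff_comap_le]
      exact hcoin.comp (comap_measurable _)
    · rw [← measurable_iff_comap_le]
      exact hf
  rw [hind.integral_fun_mul_eq_mul_integral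
    (hf.mono (others_le hM x) le_rfl).aestronglyMeasurable
    (hcoin.comp hc).aestronglyMeasurable]
  have hset : MeasurableSet {ω | coins arr ch x ω = true} := hc (measurableSet_singleton true)
  have hi : ∫ ω, coin (coins arr ch x ω) ∂P = p := by
    have : (fun ω => coin (coins arr ch x ω))
        = Set.indicator {ω | coins arr ch x ω = true} 1 := by
      ext ω
      simp [coin, Set.indicator_apply]
    rw [this, integral_indicator_one hset, measureReal_def, hx, ENNReal.toReal_ofReal hp]
  have hint : Integrable (fun ω => coin (coins arr ch x ω)) P :=
    Integrable.of_bound ((measurable_of_countable coin).comp hc).aestronglyMeasurable 1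
      (Eventually.of_forall fun ω => by
        rw [Real.norm_of_nonneg (coin_nonneg _)]; exact coin_le_one _)
  rw [integral_sub hint (integrable_const p), hi]
  simp

/-- Law of large numbers for compensated coins with predictable weights in `[0, 1]`. -/
lemma ae_tendsto_weighted_coins (hM : N.IsModel P arr ch U) {x : ℕ → (ℕ × I) ⊕ (I × ℕ)} {p : ℝ}
    (hp : 0 ≤ p) (hp1 : p ≤ 1) (hx : ∀ i, P {ω | coins arr ch (x i) ω = true} = ENNReal.ofReal p)
    (hinj : Function.Injective x) {w : ℕ → Ω → ℝ} (hw0 : ∀ i ω, 0 ≤ w i ω)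
    (hw1 : ∀ i ω, w i ω ≤ 1)
    (hw : ∀ i j, i ≤ j → Measurable[others arr ch U (x j)] (w i)) :
    ∀ᵐ ω ∂P, Tendsto (fun n : ℕ =>
      (∑ i ∈ Finset.range n, w i ω * (coin (coins arr ch (x i) ω) - p)) / (n : ℝ)) atTop (𝓝 0) := by
  have hcoin : Measurable fun c : Bool => coin c - p := measurable_of_countable _
  refine ae_tendsto_avg_of_bounded (fun i => ?_) (fun i ω => ?_) (fun i j hij => ?_)
  · exact ((hw i i le_rfl).mono (others_le hM _) le_rfl).mul
      (hcoin.comp (measurable_coins hM (x i)))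
  · rw [abs_mul]
    have h0 := coin_nonneg (coins arr ch (x i) ω)
    have h1 := coin_le_one (coins arr ch (x i) ω)
    refine mul_le_one₀ ?_ (abs_nonneg _) ?_
    · rw [abs_of_nonneg (hw0 i ω)]; exact hw1 i ω
    · rw [abs_le]; constructor <;> linarith
  · simp only [← mul_assoc]
    refine integral_mul_coin_sub hM hp (hx j) ?_
    have hi : Measurable[others arr ch U (x j)] fun ω => coin (coins arr ch (x i) ω) - p :=
      hcoin.comp (measurable_coin_others (hinj.ne hij.ne))
    exact ((hw i j hij.le).mul hi).mul (hw j j le_rfl)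

end Independence

/-! ### Random renewals -/

section RandomRenewal

variable {I : Type*} {Ω : Type*}

/-- The arrivals for user `ℓ`, with index `i` for slot `i + 1`. -/
def arrivalSeq (arr : ℕ → I → Ω → Bool) (ℓ : I) (ω : Ω) (i : ℕ) : Bool := arr (i + 1) ℓ ω

lemma measurable_lastRenewal {m : MeasurableSpace Ω} {θ : ℕ} {B : Ω → ℕ → Bool} (i : ℕ)
    (h : ∀ j < i, Measurable[m] fun ω => B ω j) :
    Measurable[m] fun ω => lastRenewal θ (B ω) i := by
  induction i with
  | zero => exact measurable_const
  | succ i ih =>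
    have ih' := ih fun j hj => h j (by omega)
    have hset : MeasurableSet[m] {ω | B ω i = true ∧ θ < i + 1 - lastRenewal θ (B ω) i} :=
      (h i (by omega) (measurableSet_singleton true)).inter
        (ih' (show MeasurableSet {n : ℕ | θ < i + 1 - n} from .of_discrete))
    exact Measurable.ite hset measurable_const ih'

lemma measurable_excess {arr : ℕ → I → Ω → Bool} {ch : I → ℕ → Ω → Bool} {U : Ω → ℝ}
    (θ : ℕ) (ℓ : I) {i j : ℕ} (hij : i ≤ j) :
    Measurable[others arr ch U (.inl (j + 1, ℓ))]
      fun ω => excess θ (arrivalSeq arr ℓ ω) i := by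
  have h : Measurable[others arr ch U (.inl (j + 1, ℓ))]
      fun ω => lastRenewal θ (arrivalSeq arr ℓ ω) i :=
    measurable_lastRenewal i fun k hk =>
      measurable_coin_others (arr := arr) (ch := ch) (y := .inl (k + 1, ℓ)) (by simp; omega)
  exact (measurable_of_countable fun n : ℕ => i + 1 - n - θ).comp h

variable [mΩ : MeasurableSpace Ω] {N : Network I} {P : Measure Ω} [IsProbabilityMeasure P]
  {arr : ℕ → I → Ω → Bool} {ch : I → ℕ → Ω → Bool} {U : Ω → ℝ}

lemma memLp_excess (hM : N.IsModel P arr ch U) (θ : ℕ) (ℓ : I) (i : ℕ) :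
    MemLp (fun ω => (excess θ (arrivalSeq arr ℓ ω) i : ℝ)) 2 P := by
  have h := (measurable_excess (arr := arr) (ch := ch) (U := U) θ ℓ (le_refl i)).mono
    (others_le hM _) le_rfl
  refine MemLp.of_bound ((measurable_of_countable fun n : ℕ => (n : ℝ)).comp h).aestronglyMeasurable
    (i + 1) (Eventually.of_forall fun ω => ?_)
  rw [Real.norm_of_nonneg (Nat.cast_nonneg _)]
  exact_mod_cast excess_le i

/-- The first two moments of the excess stay bounded, since it is reset at each arrival. -/
lemma integral_excess_le (hM : N.IsModel P arr ch U) (hq : ∀ ℓ, 0 < N.q ℓ) (hq1 : ∀ ℓ, N.q ℓ ≤ 1)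
    (θ : ℕ) (ℓ : I) (i : ℕ) :
    ∫ ω, (excess θ (arrivalSeq arr ℓ ω) i : ℝ) ∂P ≤ 1 / N.q ℓ ∧
    ∫ ω, (excess θ (arrivalSeq arr ℓ ω) i : ℝ) ^ 2 ∂P ≤ 2 / N.q ℓ ^ 2 := by
  set q := N.q ℓ
  have hq0 : 0 < q := hq ℓ
  have hq1' : q ≤ 1 := hq1 ℓ
  induction i with
  | zero =>
    have h0 : ∀ ω, (excess θ (arrivalSeq arr ℓ ω) 0 : ℝ) ≤ 1 := fun ω => by
      exact_mod_cast excess_le 0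
    constructor
    · have h := integral_mono (μ := P)
        ((memLp_excess hM θ ℓ 0).integrable (by norm_num)) (integrable_const (1 : ℝ)) h0
      simp only [integral_const, probReal_univ, one_smul] at h
      exact h.trans ((le_div_iff₀ hq0).2 (by linarith))
    · have h := integral_mono (μ := P)
        (memLp_excess hM θ ℓ 0).integrable_sq (integrable_const (1 : ℝ))
        fun ω => pow_le_one₀ (Nat.cast_nonneg _) (h0 ω)
      simp only [integral_const, probReal_univ, one_smul] at h
      exact h.trans ((le_div_iff₀ (by positivity)).2 (by nlinarith))
  | succ i ih =>
    obtain ⟨ih1, ih2⟩ := ih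
    set Y : Ω → ℝ := fun ω => (excess θ (arrivalSeq arr ℓ ω) i : ℝ)
    set Z : Ω → ℝ := fun ω => (excess θ (arrivalSeq arr ℓ ω) (i + 1) : ℝ)
    set D : Ω → ℝ := fun ω => coin (arrivalSeq arr ℓ ω i) - q with hD
    have hYm : Measurable[others arr ch U (.inl (i + 1, ℓ))] Y :=
      (measurable_of_countable fun n : ℕ => (n : ℝ)).comp (measurable_excess θ ℓ le_rfl)
    have hY2 : MemLp Y 2 P := memLp_excess hM θ ℓ i
    have hZ2 : MemLp Z 2 P := memLp_excess hM θ ℓ (i + 1)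
    have hDm : Measurable D := (measurable_of_countable fun c : Bool => coin c - q).comp
      (hM.measurable_arr (i + 1) ℓ)
    have hDb : ∀ ω, ‖D ω‖ ≤ 1 := fun ω => by
      have h0 := coin_nonneg (arrivalSeq arr ℓ ω i)
      have h1 := coin_le_one (arrivalSeq arr ℓ ω i)
      rw [Real.norm_eq_abs, abs_le]
      constructor <;> simp only [hD] <;> linarith
    have hYD : ∫ ω, Y ω * D ω ∂P = 0 :=
      integral_mul_coin_sub hM (x := .inl (i + 1, ℓ)) hq0.le (hM.arr_law _ _) hYm
    have hYYD : ∫ ω, Y ω ^ 2 * D ω ∂P = 0 :=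
      integral_mul_coin_sub hM (x := .inl (i + 1, ℓ)) hq0.le (hM.arr_law _ _) (hYm.pow_const 2)
    have iY : Integrable Y P := hY2.integrable (by norm_num)
    have iYY : Integrable (fun ω => Y ω ^ 2) P := hY2.integrable_sq
    have iYD : Integrable (fun ω => Y ω * D ω) P :=
      iY.mul_bdd (c := 1) hDm.aestronglyMeasurable (Eventually.of_forall hDb)
    have iYYD : Integrable (fun ω => Y ω ^ 2 * D ω) P :=
      iYY.mul_bdd (c := 1) hDm.aestronglyMeasurable (Eventually.of_forall hDb)
    have hstep : ∀ ω, Z ω ≤ 1 + (1 - coin (arrivalSeq arr ℓ ω i)) * Y ω :=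
      fun ω => excess_succ_le i
    have hZ0 : ∀ ω, 0 ≤ Z ω := fun ω => Nat.cast_nonneg _
    constructor
    · have i1 : Integrable (fun ω => 1 + (1 - q) * Y ω) P :=
        (integrable_const 1).add (iY.const_mul _)
      have h : ∫ ω, Z ω ∂P ≤ ∫ ω, (1 + (1 - q) * Y ω - Y ω * D ω) ∂P := by
        refine integral_mono (hZ2.integrable (by norm_num))
          (i1.sub iYD) fun ω => (hstep ω).trans (le_of_eq ?_)
        simp only [hD]; ring
      rw [integral_sub i1 iYD,
        integral_add (integrable_const 1) (iY.const_mul _), integral_const_mul, hYD] at h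
      simp only [integral_const, probReal_univ, one_smul] at h
      have h2 : (1 - q) * ∫ ω, Y ω ∂P ≤ (1 - q) * (1 / q) :=
        mul_le_mul_of_nonneg_left ih1 (by linarith)
      have h3 : 1 + (1 - q) * (1 / q) = 1 / q := by field_simp; ring
      linarith
    · have i1 : Integrable (fun ω => 1 + 2 * (1 - q) * Y ω) P :=
        (integrable_const 1).add (iY.const_mul _)
      have i2 : Integrable (fun ω => 1 + 2 * (1 - q) * Y ω + (1 - q) * Y ω ^ 2) P :=
        i1.add (iYY.const_mul _)
      have i3 : Integrable (fun ω => 2 * (Y ω * D ω) + Y ω ^ 2 * D ω) P :=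
        (iYD.const_mul 2).add iYYD
      have h : ∫ ω, Z ω ^ 2 ∂P ≤ ∫ ω, (1 + 2 * (1 - q) * Y ω + (1 - q) * Y ω ^ 2
          - (2 * (Y ω * D ω) + Y ω ^ 2 * D ω)) ∂P := by
        refine integral_mono hZ2.integrable_sq (i2.sub i3) fun ω => ?_
        have h1 : Z ω ^ 2 ≤ (1 + (1 - coin (arrivalSeq arr ℓ ω i)) * Y ω) ^ 2 :=
          pow_le_pow_left₀ (hZ0 ω) (hstep ω) 2
        refine h1.trans (le_of_eq ?_)
        have hcc : coin (arrivalSeq arr ℓ ω i) ^ 2 = coin (arrivalSeq arr ℓ ω i) := by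
          unfold coin; split_ifs <;> norm_num
        simp only [hD]
        linear_combination Y ω ^ 2 * hcc
      rw [integral_sub i2 i3, integral_add i1 (iYY.const_mul _),
        integral_add (integrable_const 1) (iY.const_mul _),
        integral_add (iYD.const_mul 2) iYYD, integral_const_mul, integral_const_mul,
        integral_const_mul, hYD, hYYD] at h
      simp only [integral_const, probReal_univ, one_smul] at h
      have h2 : 2 * (1 - q) * ∫ ω, Y ω ∂P ≤ 2 * (1 - q) * (1 / q) :=
        mul_le_mul_of_nonneg_left ih1 (by linarith)
      have h3 : (1 - q) * ∫ ω, Y ω ^ 2 ∂P ≤ (1 - q) * (2 / q ^ 2) :=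
        mul_le_mul_of_nonneg_left ih2 (by linarith)
      have h4 : 1 + 2 * (1 - q) * (1 / q) + (1 - q) * (2 / q ^ 2) = 2 / q ^ 2 - 1 := by
        field_simp; ring
      linarith

/-- The number of renewals is compensated by `q` times the number of active slots. -/
lemma ae_tendsto_active (hM : N.IsModel P arr ch U) (hq : ∀ ℓ, 0 < N.q ℓ) (hq1 : ∀ ℓ, N.q ℓ ≤ 1)
    (θ : ℕ) (ℓ : I) : ∀ᵐ ω ∂P, Tendsto (fun n : ℕ => (∑ i ∈ Finset.range n,
      active θ (arrivalSeq arr ℓ ω) i * (coin (arrivalSeq arr ℓ ω i) - N.q ℓ)) / (n : ℝ))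
      atTop (𝓝 0) :=
  ae_tendsto_weighted_coins hM (x := fun i => .inl (i + 1, ℓ)) (hq ℓ).le (hq1 ℓ)
    (fun i => hM.arr_law _ _) (fun i j h => by simpa using h)
    (w := fun i ω => active θ (arrivalSeq arr ℓ ω) i)
    (fun i ω => active_nonneg _ _ _) (fun i ω => active_le_one _ _ _)
    fun i j hij => (measurable_of_countable fun n : ℕ => if 0 < n then (1 : ℝ) else 0).comp
      (measurable_excess θ ℓ hij)

lemma ae_tendsto_excess (hM : N.IsModel P arr ch U) (hq : ∀ ℓ, 0 < N.q ℓ) (hq1 : ∀ ℓ, N.q ℓ ≤ 1)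
    (θ : ℕ) (ℓ : I) : ∀ᵐ ω ∂P, Tendsto (fun k : ℕ => (∑ i ∈ Finset.range (k ^ 2),
      excess θ (arrivalSeq arr ℓ ω) i * (coin (arrivalSeq arr ℓ ω i) - N.q ℓ)) /
      ((k ^ 2 : ℕ) : ℝ)) atTop (𝓝 0) := by
  have hcoin : Measurable fun c : Bool => coin c - N.q ℓ := measurable_of_countable _
  have hb : ∀ i ω, ‖coin (arrivalSeq arr ℓ ω i) - N.q ℓ‖ ≤ 1 := fun i ω => by
    have h0 := coin_nonneg (arrivalSeq arr ℓ ω i)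
    have h1 := coin_le_one (arrivalSeq arr ℓ ω i)
    have h2 := hq ℓ
    have h3 := hq1 ℓ
    rw [Real.norm_eq_abs, abs_le]
    constructor <;> linarith
  have hmem : ∀ i, MemLp (fun ω => (excess θ (arrivalSeq arr ℓ ω) i : ℝ)
      * (coin (arrivalSeq arr ℓ ω i) - N.q ℓ)) 2 P := fun i => by
    refine (memLp_excess hM θ ℓ i).mono ?_ (Eventually.of_forall fun ω => ?_)
    · exact (memLp_excess hM θ ℓ i).aestronglyMeasurable.mul
        (hcoin.comp (hM.measurable_arr (i + 1) ℓ)).aestronglyMeasurable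
    · rw [norm_mul]
      exact mul_le_of_le_one_right (norm_nonneg _) (hb i ω)
  refine ae_tendsto_avg_sq hmem (fun i j hij => ?_) (C := 2 / N.q ℓ ^ 2) fun i => ?_
  · simp only [← mul_assoc]
    refine integral_mul_coin_sub hM (x := .inl (j + 1, ℓ)) (hq ℓ).le (hM.arr_law _ _) ?_
    have hcast := measurable_of_countable fun n : ℕ => (n : ℝ)
    have hi : Measurable[others arr ch U (.inl (j + 1, ℓ))]
        fun ω => coin (arrivalSeq arr ℓ ω i) - N.q ℓ :=
      hcoin.comp (measurable_coin_others (arr := arr) (ch := ch) (y := .inl (i + 1, ℓ))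
        (by simp; omega))
    exact ((hcast.comp (measurable_excess θ ℓ hij.le)).mul hi).mul
      (hcast.comp (measurable_excess θ ℓ le_rfl))
  · refine (integral_mono (hmem i).integrable_sq (memLp_excess hM θ ℓ i).integrable_sq
      fun ω => ?_).trans (integral_excess_le hM hq hq1 θ ℓ i).2
    have h := hb i ω
    rw [Real.norm_eq_abs] at h
    simp only [mul_pow]
    exact mul_le_of_le_one_right (sq_nonneg _) ((sq_le_one_iff_abs_le_one _).2 h)

end RandomRenewal

/-! ### Selected and delivered packets -/

section Gaps

lemma gap_insert_of_mem {D : Finset ℕ} {a g : ℕ} (ha : ∀ x ∈ D, x < a) (hg : g ∈ D) :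
    gap (insert a D) g = gap D g := by
  have : (insert a D).filter (· < g) = D.filter (· < g) := by
    have := ha g hg
    rw [Finset.filter_insert, if_neg (by omega)]
  simp only [gap, this]

lemma gap_insert_self {D : Finset ℕ} {a : ℕ} (ha : ∀ x ∈ D, x < a) :
    gap (insert a D) a = (a : ℝ) - (D.sup id : ℕ) := by
  have : (insert a D).filter (· < a) = D := by
    rw [Finset.filter_insert, if_neg (lt_irrefl a), Finset.filter_true_of_mem ha]
  simp only [gap, this]

lemma sum_gap (D : Finset ℕ) : ∑ g ∈ D, gap D g = (D.sup id : ℕ) := by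
  induction D using Finset.induction_on_max with
  | empty => simp
  | insert a D ha ih =>
    have hna : a ∉ D := fun h => lt_irrefl a (ha a h)
    rw [Finset.sum_insert hna, gap_insert_self ha,
      Finset.sum_congr rfl fun g hg => gap_insert_of_mem ha hg, ih, Finset.sup_insert]
    have : D.sup id ≤ a := Finset.sup_le fun x hx => (ha x hx).le
    simp [sup_eq_left.2 this]

end Gaps

lemma Run.mem_delivered {I : Type*} {r : Run I} {ℓ : I} {t g : ℕ} :
    g ∈ r.delivered ℓ t ↔
      1 ≤ g ∧ g ≤ t ∧ ∃ s, 1 ≤ s ∧ s ≤ t ∧ r.tx s = some (ℓ, g) ∧ r.ok s = true := by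
  simp [Run.delivered, and_assoc]

lemma Run.delivered_mono {I : Type*} (r : Run I) (ℓ : I) : Monotone (r.delivered ℓ) := by
  intro s t hst g hg
  rw [Run.mem_delivered] at hg ⊢
  obtain ⟨h1, h2, u, h3, h4, h5⟩ := hg
  exact ⟨h1, h2.trans hst, u, h3, h4.trans hst, h5⟩

namespace Network

variable {I : Type*} {N : Network I}

section Selected

variable {T : I → ℝ} {r : Run I} {ℓ : I} {θ : ℕ}

lemma lastIncrement_eq (hθ : N.threshold T ℓ = θ) (t : ℕ) :
    N.lastIncrement T r ℓ t = lastRenewal θ (fun i => r.arr (i + 1) ℓ) t := by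
  induction t with
  | zero => rfl
  | succ t ih =>
    have hle := lastRenewal_le (θ := θ) (b := fun i => r.arr (i + 1) ℓ) t
    simp only [lastIncrement, lastRenewal, hθ, ih]
    congr 1
    simp only [eq_iff_iff, and_congr_right_iff]
    intro _
    omega

lemma mem_selected {t g : ℕ} : g ∈ N.selected T r ℓ t ↔ 1 ≤ g ∧ g ≤ t ∧ r.arr g ℓ = true ∧
    N.threshold T ℓ < (g : ℤ) - (N.lastIncrement T r ℓ (g - 1) : ℤ) := by
  simp [selected, and_assoc]

lemma selected_succ (hθ : N.threshold T ℓ = θ) (t : ℕ) :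
    N.selected T r ℓ (t + 1) =
      if r.arr (t + 1) ℓ = true ∧ 0 < excess θ (fun i => r.arr (i + 1) ℓ) t
      then insert (t + 1) (N.selected T r ℓ t) else N.selected T r ℓ t := by
  have hle := lastRenewal_le (θ := θ) (b := fun i => r.arr (i + 1) ℓ) t
  have hcond : (r.arr (t + 1) ℓ = true ∧ 0 < excess θ (fun i => r.arr (i + 1) ℓ) t) ↔
      r.arr (t + 1) ℓ = true ∧ N.threshold T ℓ
        < ((t + 1 : ℕ) : ℤ) - (N.lastIncrement T r ℓ (t + 1 - 1) : ℤ) := by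
    rw [hθ, Nat.add_sub_cancel, lastIncrement_eq hθ]
    unfold excess
    refine and_congr_right fun _ => ?_
    omega
  simp only [selected, ← Finset.insert_Icc_right_eq_Icc_add_one (show 1 ≤ t + 1 by omega),
    Finset.filter_insert]
  by_cases h : r.arr (t + 1) ℓ = true ∧ 0 < excess θ (fun i => r.arr (i + 1) ℓ) t
  · rw [if_pos h, if_pos (hcond.1 h)]
  · rw [if_neg h, if_neg (hcond.not.1 h)]

lemma lt_succ_of_mem_selected {t g : ℕ} (hg : g ∈ N.selected T r ℓ t) : g < t + 1 := by
  have := (mem_selected.1 hg).2.1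
  omega

lemma sup_selected (hθ : N.threshold T ℓ = θ) (t : ℕ) :
    (N.selected T r ℓ t).sup id = lastRenewal θ (fun i => r.arr (i + 1) ℓ) t := by
  induction t with
  | zero => simp [selected, lastRenewal]
  | succ t ih =>
    have hle := lastRenewal_le (θ := θ) (b := fun i => r.arr (i + 1) ℓ) t
    rw [selected_succ hθ]
    rcases lastRenewal_succ (θ := θ) (b := fun i => r.arr (i + 1) ℓ) t with
      ⟨h1, h2, h, -⟩ | ⟨hn, h, -⟩
    · rw [if_pos ⟨h1, h2⟩, h, Finset.sup_insert, ih, id]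
      exact sup_eq_left.2 (by omega)
    · rw [if_neg hn, h, ih]

/-- Sums over the selected packets are sums over the renewals. -/
lemma sum_selected (hθ : N.threshold T ℓ = θ) (f : ℝ → ℝ) (t : ℕ) :
    ∑ g ∈ N.selected T r ℓ t, f (gap (N.selected T r ℓ t) g)
      = ∑ i ∈ Finset.range t, active θ (fun i => r.arr (i + 1) ℓ) i * coin (r.arr (i + 1) ℓ)
        * f (excess θ (fun i => r.arr (i + 1) ℓ) i + θ) := by
  induction t with
  | zero => simp [selected]
  | succ t ih =>
    rw [Finset.sum_range_succ, ← ih, selected_succ hθ]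
    have hle := lastRenewal_le (θ := θ) (b := fun i => r.arr (i + 1) ℓ) t
    rcases lastRenewal_succ (θ := θ) (b := fun i => r.arr (i + 1) ℓ) t with
      ⟨h1, h2, -, h0⟩ | ⟨hn, -, h0⟩
    · have hmax : ∀ x ∈ N.selected T r ℓ t, x < t + 1 := fun x => lt_succ_of_mem_selected
      rw [if_pos ⟨h1, h2⟩, Finset.sum_insert fun h => lt_irrefl _ (hmax _ h), gap_insert_self hmax,
        Finset.sum_congr rfl fun g hg => by rw [gap_insert_of_mem hmax hg], sup_selected hθ]
      have : ((excess θ (fun i => r.arr (i + 1) ℓ) t : ℕ) : ℝ) + θ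
          = ((t + 1 : ℕ) : ℝ) - (lastRenewal θ (fun i => r.arr (i + 1) ℓ) t : ℕ) := by
        unfold excess at h2 ⊢
        rw [Nat.cast_sub (by omega), Nat.cast_sub (by omega)]
        ring
      rw [this, h0]
      ring
    · rw [if_neg hn, h0]
      ring

lemma card_selected (hθ : N.threshold T ℓ = θ) (t : ℕ) :
    ((N.selected T r ℓ t).card : ℝ) = renewals θ (fun i => r.arr (i + 1) ℓ) t := by
  simpa [renewals] using sum_selected (r := r) hθ (fun _ => 1) t

/-- The limits for the selected packets, on a sample path that obeys the laws of large numbers. -/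
lemma selected_limits (hθ : N.threshold T ℓ = θ) (hq : 0 < N.q ℓ)
    (h1 : Tendsto (fun n : ℕ => (∑ i ∈ Finset.range n, active θ (fun i => r.arr (i + 1) ℓ) i
      * (coin (r.arr (i + 1) ℓ) - N.q ℓ)) / (n : ℝ)) atTop (𝓝 0))
    (h2 : Tendsto (fun k : ℕ => (∑ i ∈ Finset.range (k ^ 2),
      excess θ (fun i => r.arr (i + 1) ℓ) i * (coin (r.arr (i + 1) ℓ) - N.q ℓ)) /
      ((k ^ 2 : ℕ) : ℝ)) atTop (𝓝 0)) :
    HasMeanGap (N.selected T r ℓ) (θ + 1 / N.q ℓ) ∧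
    HasGapVariance (N.selected T r ℓ) (θ + 1 / N.q ℓ) ((1 - N.q ℓ) / N.q ℓ ^ 2) ∧
    Tendsto (fun t => (N.selected T r ℓ t).sup id) atTop atTop := by
  refine ⟨?_, ?_, ?_⟩
  · simp only [HasMeanGap, sum_gap, card_selected hθ, sup_selected hθ]
    exact tendsto_lastRenewal_div_renewals hq h1
  · have h := tendsto_renewal_variance hq h1 h2
    simp only [HasGapVariance]
    refine h.congr fun n => ?_
    rw [sum_selected hθ (fun x => (x - (θ + 1 / N.q ℓ)) ^ 2), card_selected hθ]
    congr 1
    refine Finset.sum_congr rfl fun i _ => ?_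
    ring
  · simp only [sup_selected hθ]
    exact tendsto_lastRenewal hq h1

end Selected

section Target

variable [Fintype I] {T : I → ℝ}

/-- At the optimum `T ℓ > 1 / q ℓ - 1`: on `[1, 1 / q ℓ - 1]` the cost of user `ℓ` exceeds its cost
at `1 / q ℓ - 1 / 2`, and increasing `T ℓ` preserves feasibility. -/
lemma IsTarget.lt (hT : N.IsTarget T) (hN : N.Valid) {ℓ : I} (hℓ : ℓ ∈ N.users .aoi) :
    1 / N.q ℓ - 1 < T ℓ := by
  classical
  by_contra! hcon
  obtain ⟨⟨hf, h1⟩, hopt⟩ := hT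
  have hq := hN.q_pos ℓ
  set x : ℝ := 1 / N.q ℓ - 1 / 2 with hx
  have hTℓ := h1 ℓ hℓ
  have hxT : T ℓ < x := by rw [hx]; linarith
  have hx0 : 0 < x := by linarith
  have hfeas : N.TargetFeasible (Function.update T ℓ x) := by
    constructor
    · refine (Finset.sum_le_sum fun k hk => ?_).trans hf
      by_cases hkℓ : k = ℓ
      · subst hkℓ
        rw [Function.update_self]
        have := hN.p_pos k
        gcongr
      · rw [Function.update_of_ne hkℓ]
    · intro k hk
      by_cases hkℓ : k = ℓ
      · subst hkℓ
        rw [Function.update_self]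
        linarith
      · rw [Function.update_of_ne hkℓ]
        exact h1 k hk
  have hle := hopt _ hfeas
  refine absurd hle (not_le.2 ?_)
  have hρ := hN.ρ_pos ℓ hℓ
  set v : ℝ := (1 - N.q ℓ) / N.q ℓ ^ 2 with hv
  have hv' : v = 1 / N.q ℓ * (1 / N.q ℓ - 1) := by rw [hv]; field_simp
  have hkey : x + v / x < T ℓ + v / T ℓ := by
    have e1 : x + v / x < 2 / N.q ℓ - 1 := by
      have : 2 / N.q ℓ - 1 - (x + v / x) = 1 / 4 / x := by
        rw [hv', eq_div_iff hx0.ne', sub_mul, add_mul, div_mul_cancel₀ _ hx0.ne', hx]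
        ring
      have h4 : 0 < 1 / 4 / x := by positivity
      linarith
    have e2 : 2 / N.q ℓ - 1 ≤ T ℓ + v / T ℓ := by
      have hT0 : 0 < T ℓ := by linarith
      have : T ℓ + v / T ℓ - (2 / N.q ℓ - 1)
          = (1 / N.q ℓ - T ℓ) * (1 / N.q ℓ - 1 - T ℓ) / T ℓ := by
        rw [hv', eq_div_iff hT0.ne', sub_mul, add_mul, div_mul_cancel₀ _ hT0.ne']
        ring
      have h4 : 0 ≤ (1 / N.q ℓ - T ℓ) * (1 / N.q ℓ - 1 - T ℓ) / T ℓ :=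
        div_nonneg (mul_nonneg (by linarith) (by linarith)) hT0.le
      linarith
    linarith
  refine Finset.sum_lt_sum (fun k hk => ?_) ⟨ℓ, hℓ, ?_⟩
  · by_cases hkℓ : k = ℓ
    · subst hkℓ
      rw [Function.update_self]
      exact mul_le_mul_of_nonneg_left hkey.le (by linarith)
    · rw [Function.update_of_ne hkℓ]
  · rw [Function.update_self]
    exact mul_lt_mul_of_pos_left hkey (by linarith)

lemma IsTarget.exists_threshold (hT : N.IsTarget T) (hN : N.Valid) {ℓ : I}
    (hℓ : ℓ ∈ N.users .aoi) : ∃ θ : ℕ, N.threshold T ℓ = θ ∧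
      (θ : ℝ) + 1 / N.q ℓ ∈ Set.Ico (T ℓ) (T ℓ + 1) := by
  have h := hT.lt hN hℓ
  have h0 : 0 ≤ N.threshold T ℓ := by
    have : (-1 : ℤ) < ⌈T ℓ - 1 / N.q ℓ⌉ := Int.lt_ceil.2 (by push_cast; linarith)
    unfold threshold
    omega
  obtain ⟨θ, hθ⟩ := Int.eq_ofNat_of_zero_le h0
  refine ⟨θ, hθ, ?_⟩
  have h1 := Int.le_ceil (T ℓ - 1 / N.q ℓ)
  have h2 := Int.ceil_lt_add_one (T ℓ - 1 / N.q ℓ)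
  have h3 : ((⌈T ℓ - 1 / N.q ℓ⌉ : ℤ) : ℝ) = θ := by
    have : ⌈T ℓ - 1 / N.q ℓ⌉ = (θ : ℤ) := hθ
    rw [this]
    simp
  rw [h3] at h1 h2
  constructor <;> linarith

lemma F1_lt_F1Bound (hN : N.Valid) (hA : (N.users .aoi).Nonempty) (hT : N.IsTarget T)
    {D : I → ℕ → Finset ℕ}
    (h : ∀ ℓ ∈ N.users .aoi, ∃ m ∈ Set.Ico (T ℓ) (T ℓ + 1), HasMeanGap (D ℓ) m ∧
      HasGapVariance (D ℓ) m ((1 - N.q ℓ) / N.q ℓ ^ 2)) :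
    N.F1 D < ((N.F1Bound T : ℝ) : EReal) := by
  choose! m hm hD using h
  refine lt_of_le_of_lt (sInf_le ⟨m, fun ℓ => (1 - N.q ℓ) / N.q ℓ ^ 2, hD, rfl⟩) ?_
  rw [EReal.coe_lt_coe_iff]
  refine Finset.sum_lt_sum_of_nonempty hA fun ℓ hℓ => ?_
  have hρ := hN.ρ_pos ℓ hℓ
  have hT1 := hT.1.2 ℓ hℓ
  have hq := hN.q_pos ℓ
  have hq1 := hN.q_le ℓ
  obtain ⟨h1, h2⟩ := hm ℓ hℓ
  have h3 : (1 - N.q ℓ) / N.q ℓ ^ 2 / m ℓ ≤ (1 - N.q ℓ) / N.q ℓ ^ 2 / T ℓ :=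
    div_le_div_of_nonneg_left (div_nonneg (by linarith) (by positivity)) (by linarith) h1
  exact mul_lt_mul_of_pos_left (by linarith) (by linarith)

end Target

section Delivered

variable {T : I → ℝ} {r : Run I} {ℓ : I}

/-- A packet is admitted as high priority packet of `ℓ` when it arrives in slot `g`. -/
def Admitted (N : Network I) (T : I → ℝ) (r : Run I) (ℓ : I) (g : ℕ) : Prop :=
  r.arr g ℓ = true ∧ (r.delivered ℓ (g - 1)).card < N.counter T r ℓ g

lemma refresh_cases {t x : ℕ} {o : Option ℕ} (h : N.refresh T r ℓ t o = some x) :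
    (N.Admitted T r ℓ t ∧ x = t) ∨ (¬ N.Admitted T r ℓ t ∧ o = some x) := by
  unfold refresh at h
  split_ifs at h with hc
  · exact .inl ⟨hc, by simpa using h.symm⟩
  · exact .inr ⟨hc, h⟩

lemma selected_mono (N : Network I) (T : I → ℝ) (r : Run I) (ℓ : I) :
    Monotone (N.selected T r ℓ) := by
  intro s t hst g hg
  rw [mem_selected] at hg ⊢
  exact ⟨hg.1, hg.2.1.trans hst, hg.2.2⟩

variable [DecidableEq I]

lemma held_cases {t x : ℕ} (h : N.held T r ℓ (t + 1) = some x) :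
    N.refresh T r ℓ (t + 1) (N.held T r ℓ t) = some x := by
  rw [held] at h
  split_ifs at h
  exact h

lemma held_admitted {t x : ℕ} (h : N.held T r ℓ t = some x) : x ≤ t ∧ N.Admitted T r ℓ x := by
  induction t with
  | zero => simp [held] at h
  | succ t ih =>
    rcases refresh_cases (held_cases h) with ⟨h1, rfl⟩ | ⟨-, h2⟩
    · exact ⟨le_rfl, h1⟩
    · exact ⟨(ih h2).1.trans (Nat.le_succ t), (ih h2).2⟩

lemma refresh_admitted {t x : ℕ} (h : N.refresh T r ℓ t (N.held T r ℓ (t - 1)) = some x) :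
    x ≤ t ∧ N.Admitted T r ℓ x := by
  rcases refresh_cases h with ⟨h1, rfl⟩ | ⟨-, h2⟩
  · exact ⟨le_rfl, h1⟩
  · have := held_admitted h2
    exact ⟨by omega, this.2⟩

/-- An admitted packet replaces all older ones for good. -/
lemma le_of_held {g t x : ℕ} (hg : N.Admitted T r ℓ g) (hgt : g ≤ t)
    (h : N.held T r ℓ t = some x) : g ≤ x := by
  induction t with
  | zero => simp [held] at h
  | succ t ih =>
    rcases refresh_cases (held_cases h) with ⟨-, rfl⟩ | ⟨hn, h2⟩
    · exact hgt
    · rcases Nat.lt_or_ge t g with h3 | h3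
      · have : g = t + 1 := by omega
        subst this
        exact absurd hg hn
      · exact ih h3 h2

lemma le_of_refresh {g t x : ℕ} (hg : N.Admitted T r ℓ g) (hgt : g ≤ t)
    (h : N.refresh T r ℓ t (N.held T r ℓ (t - 1)) = some x) : g ≤ x := by
  rcases refresh_cases h with ⟨-, rfl⟩ | ⟨hn, h2⟩
  · exact hgt
  · refine le_of_held hg ?_ h2
    rcases Nat.lt_or_ge (t - 1) g with h3 | h3
    · have : g = t := by omega
      subst this
      exact absurd hg hn
    · exact h3

variable [Fintype I]

/-- AoI users are served with their high priority packets only. -/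
lemma Rule.refresh_eq {t g : ℕ} (h : N.Rule T r t) (hℓ : ℓ ∈ N.users .aoi)
    (htx : r.tx t = some (ℓ, g)) : N.refresh T r ℓ t (N.held T r ℓ (t - 1)) = some g := by
  have hkind : N.kind ℓ = .aoi := (Finset.mem_filter.1 hℓ).2
  obtain ⟨h1, h2, h3⟩ := h
  by_cases hpos : ∃ ℓ, 0 < N.index T r ℓ t
  · obtain ⟨ℓ', g', -, hp, htx'⟩ := h1 hpos
    rw [htx] at htx'
    obtain ⟨rfl, rfl⟩ : ℓ = ℓ' ∧ g = g' := by simpa using htx'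
    simpa [priorityPacket, hkind] using hp
  · by_cases hthr : (N.users .thr).Nonempty
    · obtain ⟨k, hk, g', -, htx'⟩ := h2 hpos hthr
      rw [htx] at htx'
      obtain ⟨rfl, rfl⟩ : ℓ = k ∧ g = g' := by simpa using htx'
      have := (Finset.mem_filter.1 hk).2
      rw [hkind] at this
      cases this
    · rw [h3 hpos hthr] at htx
      cases htx

/-- Once a packet has been admitted, older packets which have not been received are lost. -/
lemma mem_delivered_of_admitted (hr : ∀ t, 1 ≤ t → N.Rule T r t) (hℓ : ℓ ∈ N.users .aoi)
    {g x s : ℕ} (hg : N.Admitted T r ℓ g) (hxg : x < g) (hx : x ∈ r.delivered ℓ s) :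
    x ∈ r.delivered ℓ (g - 1) := by
  rw [Run.mem_delivered] at hx ⊢
  obtain ⟨h1, h2, u, h3, h4, h5, h6⟩ := hx
  refine ⟨h1, by omega, u, h3, ?_, h5, h6⟩
  by_contra hu
  have := le_of_refresh hg (t := u) (by omega) ((hr u h3).refresh_eq hℓ h5)
  omega

/-- If all selected packets are received, then only selected packets are received: an admitted
packet that is not selected would replace a selected one. -/
lemma delivered_subset_selected (hr : ∀ t, 1 ≤ t → N.Rule T r t) (hℓ : ℓ ∈ N.users .aoi)
    (hall : ∀ t, ∀ g ∈ N.selected T r ℓ t, ∃ s, g ∈ r.delivered ℓ s) (t : ℕ) :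
    r.delivered ℓ t ⊆ N.selected T r ℓ t := by
  intro g hg
  obtain ⟨h1, h2, u, h3, h4, h5, h6⟩ := Run.mem_delivered.1 hg
  have hadm := (refresh_admitted ((hr u h3).refresh_eq hℓ h5)).2
  by_contra hns
  obtain ⟨x, hx, hxn⟩ := Finset.exists_mem_notMem_of_card_lt_card hadm.2
  obtain ⟨s, hs⟩ := hall _ _ hx
  have hxg : x < g := by
    refine lt_of_le_of_ne (mem_selected.1 hx).2.1 ?_
    rintro rfl
    exact hns (selected_mono N T r ℓ h2 hx)
  exact hxn (mem_delivered_of_admitted hr hℓ hadm hxg hs)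

lemma admitted_of_mem_selected (hr : ∀ t, 1 ≤ t → N.Rule T r t) (hℓ : ℓ ∈ N.users .aoi)
    (hall : ∀ t, ∀ g ∈ N.selected T r ℓ t, ∃ s, g ∈ r.delivered ℓ s) {t g : ℕ}
    (hg : g ∈ N.selected T r ℓ t) : N.Admitted T r ℓ g := by
  have h := mem_selected.1 hg
  refine ⟨h.2.2.1, Finset.card_lt_card ⟨?_, fun hsub => ?_⟩⟩
  · exact (delivered_subset_selected hr hℓ hall _).trans (selected_mono N T r ℓ (Nat.sub_le _ _))
  · have hgg : g ∈ N.selected T r ℓ g := mem_selected.2 ⟨h.1, le_rfl, h.2.2⟩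
    have := (Run.mem_delivered.1 (hsub hgg)).2.1
    omega

/-- If all selected packets are received, then the received packets are at any time an initial
segment of the selected ones. -/
lemma delivered_eq_selected (hr : ∀ t, 1 ≤ t → N.Rule T r t) (hℓ : ℓ ∈ N.users .aoi)
    (hall : ∀ t, ∀ g ∈ N.selected T r ℓ t, ∃ s, g ∈ r.delivered ℓ s) (t : ℕ) :
    r.delivered ℓ t = N.selected T r ℓ ((r.delivered ℓ t).sup id) := by
  have hsub := delivered_subset_selected hr hℓ hall t
  ext g
  constructor
  · intro hg
    exact mem_selected.2 ⟨(mem_selected.1 (hsub hg)).1, Finset.le_sup (f := id) hg,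
      (mem_selected.1 (hsub hg)).2.2⟩
  · intro hg
    have hgs := mem_selected.1 hg
    have hne : (r.delivered ℓ t).Nonempty := by
      rw [Finset.nonempty_iff_ne_empty]
      intro h
      have h1 := hgs.1
      have h2 := hgs.2.1
      rw [h] at h2
      simp at h2
      omega
    obtain ⟨M, hM, hMs⟩ := Finset.exists_mem_eq_sup _ hne id
    rcases hgs.2.1.eq_or_lt with h | h
    · rw [h, hMs]
      exact hM
    · obtain ⟨s, hs⟩ := hall _ _ hg
      have hadm := admitted_of_mem_selected hr hℓ hall (hsub hM)
      rw [hMs] at h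
      have := (Run.mem_delivered.1 hM).2.1
      exact r.delivered_mono ℓ (by omega) (mem_delivered_of_admitted hr hℓ hadm h hs)

lemma delivered_limits (hr : ∀ t, 1 ≤ t → N.Rule T r t) (hℓ : ℓ ∈ N.users .aoi)
    (hall : ∀ t, ∀ g ∈ N.selected T r ℓ t, ∃ s, g ∈ r.delivered ℓ s)
    (hinf : Tendsto (fun t => (N.selected T r ℓ t).sup id) atTop atTop) {m v : ℝ}
    (hm : HasMeanGap (N.selected T r ℓ) m) (hv : HasGapVariance (N.selected T r ℓ) m v) :
    HasMeanGap (r.delivered ℓ) m ∧ HasGapVariance (r.delivered ℓ) m v := by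
  have hτ : Tendsto (fun t => (r.delivered ℓ t).sup id) atTop atTop := by
    refine tendsto_atTop_atTop_of_monotone
      (fun s t hst => Finset.sup_mono (r.delivered_mono ℓ hst)) fun K => ?_
    obtain ⟨t, ht⟩ := (hinf.eventually_gt_atTop K).exists
    obtain ⟨g, hg, hKg⟩ := (Finset.lt_sup_iff).1 ht
    obtain ⟨s, hs⟩ := hall t g hg
    exact ⟨s, le_trans (le_of_lt hKg) (Finset.le_sup (f := id) hs)⟩
  constructor
  · refine (hm.comp hτ).congr fun t => ?_
    simp only [Function.comp_def]
    rw [← delivered_eq_selected hr hℓ hall t]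
  · refine (hv.comp hτ).congr fun t => ?_
    simp only [Function.comp_def]
    rw [← delivered_eq_selected hr hℓ hall t]

end Delivered

end Network

/-! ### Causal policies: measurability and the success rate -/

section PolicyMeasurability

variable {I : Type*} [Fintype I] {Ω : Type*} {m : MeasurableSpace Ω}
  {arr : ℕ → I → Ω → Bool} {ch : I → ℕ → Ω → Bool} {U : Ω → ℝ}

lemma measurableSet_arrivalHistory (t : ℕ)
    (harr : ∀ s ≤ t, ∀ ℓ, Measurable[m] (arr s ℓ)) (as : List (I → Bool)) :
    MeasurableSet[m] {ω | arrivalHistory (fun t ℓ => arr t ℓ ω) t = as} := by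
  induction t generalizing as with
  | zero => exact MeasurableSet.const ([] = as)
  | succ t ih =>
    cases as with
    | nil => simp [arrivalHistory]
    | cons a l =>
      have h1 : MeasurableSet[m] (⋂ ℓ, {ω | arr (t + 1) ℓ ω = a ℓ}) :=
        MeasurableSet.iInter fun ℓ => harr (t + 1) le_rfl ℓ (measurableSet_singleton _)
      convert h1.inter (ih (fun s hs => harr s (by omega)) l) using 1
      ext ω
      simp [arrivalHistory, funext_iff]

variable {choose : ℝ → List (I → Bool) → List Bool → Option (I × ℕ)}

lemma measurableSet_choose (hchoose : ∀ as fs x, MeasurableSet {u : ℝ | choose u as fs = x})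
    (t : ℕ) (hU : Measurable[m] U) (harr : ∀ s ≤ t + 1, ∀ ℓ, Measurable[m] (arr s ℓ))
    (hf : ∀ fs, MeasurableSet[m] {ω | feedbackHistory choose (U ω) (fun t ℓ => arr t ℓ ω)
      (fun ℓ t => ch ℓ t ω) t = fs}) (x : Option (I × ℕ)) :
    MeasurableSet[m] {ω | choose (U ω) (arrivalHistory (fun t ℓ => arr t ℓ ω) (t + 1))
      (feedbackHistory choose (U ω) (fun t ℓ => arr t ℓ ω) (fun ℓ t => ch ℓ t ω) t) = x} := by
  have h : MeasurableSet[m] (⋃ as : List (I → Bool), ⋃ fs : List Bool,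
      {ω | arrivalHistory (fun t ℓ => arr t ℓ ω) (t + 1) = as} ∩
      {ω | feedbackHistory choose (U ω) (fun t ℓ => arr t ℓ ω) (fun ℓ t => ch ℓ t ω) t = fs} ∩
      U ⁻¹' {u | choose u as fs = x}) :=
    MeasurableSet.iUnion fun as => MeasurableSet.iUnion fun fs =>
      ((measurableSet_arrivalHistory _ harr as).inter (hf fs)).inter (hU (hchoose as fs x))
  convert h using 1
  ext ω
  simp

lemma measurableSet_feedbackHistory
    (hchoose : ∀ as fs x, MeasurableSet {u : ℝ | choose u as fs = x}) (t : ℕ)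
    (hU : Measurable[m] U) (harr : ∀ s ≤ t, ∀ ℓ, Measurable[m] (arr s ℓ))
    (hch : ∀ s ≤ t, ∀ ℓ, Measurable[m] (ch ℓ s)) (fs : List Bool) :
    MeasurableSet[m] {ω | feedbackHistory choose (U ω) (fun t ℓ => arr t ℓ ω)
      (fun ℓ t => ch ℓ t ω) t = fs} := by
  induction t generalizing fs with
  | zero => exact MeasurableSet.const ([] = fs)
  | succ t ih =>
    have ih' := ih (fun s hs => harr s (by omega)) (fun s hs => hch s (by omega))
    cases fs with
    | nil => simp [feedbackHistory]
    | cons b l =>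
      have hout : ∀ x : Option (I × ℕ), MeasurableSet[m]
          {ω | outcome (fun ℓ t => ch ℓ t ω) (t + 1) x = b} := by
        intro x
        rcases x with _ | ⟨ℓ, g⟩
        · exact MeasurableSet.const (false = b)
        · exact hch (t + 1) le_rfl ℓ (measurableSet_singleton b)
      have h : MeasurableSet[m] (⋃ x : Option (I × ℕ),
          {ω | choose (U ω) (arrivalHistory (fun t ℓ => arr t ℓ ω) (t + 1))
            (feedbackHistory choose (U ω) (fun t ℓ => arr t ℓ ω) (fun ℓ t => ch ℓ t ω) t) = x} ∩
          {ω | outcome (fun ℓ t => ch ℓ t ω) (t + 1) x = b}) :=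
        MeasurableSet.iUnion fun x => (measurableSet_choose hchoose t hU harr ih' x).inter (hout x)
      convert h.inter (ih' l) using 1
      ext ω
      simp [feedbackHistory]

/-- The transmission of a slot depends on the seed, the arrivals until this slot and the channel
states of the preceding slots. -/
lemma measurableSet_transmission
    (hchoose : ∀ as fs x, MeasurableSet {u : ℝ | choose u as fs = x}) (t : ℕ)
    (hU : Measurable[m] U) (harr : ∀ s ≤ t + 1, ∀ ℓ, Measurable[m] (arr s ℓ))
    (hch : ∀ s ≤ t, ∀ ℓ, Measurable[m] (ch ℓ s)) (x : Option (I × ℕ)) :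
    MeasurableSet[m] {ω | transmission choose (U ω) (fun t ℓ => arr t ℓ ω)
      (fun ℓ t => ch ℓ t ω) (t + 1) = x} :=
  measurableSet_choose hchoose t hU harr (measurableSet_feedbackHistory hchoose t hU
    (fun s hs => harr s (by omega)) hch) x

end PolicyMeasurability

section Attempts

variable {I : Type*}

/-- Indicator of a transmission to user `ℓ` in slot `i + 1`. -/
def attempt [DecidableEq I] (r : Run I) (ℓ : I) (i : ℕ) : ℝ :=
  if (r.tx (i + 1)).map Prod.fst = some ℓ then 1 else 0

lemma attempt_nonneg [DecidableEq I] (r : Run I) (ℓ : I) (i : ℕ) : 0 ≤ attempt r ℓ i := by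
  unfold attempt; split_ifs <;> norm_num

lemma attempt_le_one [DecidableEq I] (r : Run I) (ℓ : I) (i : ℕ) : attempt r ℓ i ≤ 1 := by
  unfold attempt; split_ifs <;> norm_num

lemma sum_attempt_le [Fintype I] [DecidableEq I] (r : Run I) (i : ℕ) :
    ∑ ℓ, attempt r ℓ i ≤ 1 := by
  unfold attempt
  rcases h : (r.tx (i + 1)).map Prod.fst with _ | k
  · simp
  · simp

variable [Fintype I] {Ω : Type*} [MeasurableSpace Ω] {N : Network I}
  {P : Measure Ω} [IsProbabilityMeasure P]
  {arr : ℕ → I → Ω → Bool} {ch : I → ℕ → Ω → Bool} {U : Ω → ℝ}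

lemma ae_tendsto_arrivals (hM : N.IsModel P arr ch U) (hN : N.Valid) (ℓ : I) :
    ∀ᵐ ω ∂P, Tendsto (fun n : ℕ => (∑ i ∈ Finset.range n, coin (arr (i + 1) ℓ ω)) / (n : ℝ))
      atTop (𝓝 (N.q ℓ)) := by
  filter_upwards [ae_tendsto_weighted_coins hM (x := fun i => .inl (i + 1, ℓ)) (hN.q_pos ℓ).le
    (hN.q_le ℓ) (fun i => hM.arr_law _ _) (fun i j h => by simpa using h)
    (w := fun _ _ => 1) (fun i ω => zero_le_one) (fun i ω => le_rfl)
    fun i j hij => measurable_const] with ω hω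
  refine Tendsto.congr' ?_ ((hω.add_const (N.q ℓ)).trans (by simp))
  filter_upwards [eventually_gt_atTop 0] with n hn
  have hn' : (n : ℝ) ≠ 0 := by positivity
  simp only [one_mul, Finset.sum_sub_distrib, Finset.sum_const, Finset.card_range, nsmul_eq_mul]
  rw [sub_div, mul_div_cancel_left₀ _ hn', sub_add_cancel]
  rfl

variable [DecidableEq I]

/-- Under any causal policy, the number of successes is compensated by `p` times the number of
attempts. -/
lemma ae_tendsto_attempts (hM : N.IsModel P arr ch U) (hN : N.Valid) (π : Policy I) (ℓ : I) :
    ∀ᵐ ω ∂P, Tendsto (fun n : ℕ => (∑ i ∈ Finset.range n,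
      attempt (Network.path arr ch U π ω) ℓ i * (coin (ch ℓ (i + 1) ω) - N.p ℓ)) / (n : ℝ))
      atTop (𝓝 0) := by
  refine ae_tendsto_weighted_coins hM (x := fun i => .inr (ℓ, i + 1)) (hN.p_pos ℓ).le (hN.p_le ℓ)
    (fun i => hM.ch_law _ _) (fun i j h => by simpa using h)
    (w := fun i ω => attempt (Network.path arr ch U π ω) ℓ i)
    (fun i ω => attempt_nonneg _ _ _) (fun i ω => attempt_le_one _ _ _) fun i j hij => ?_
  classical
  have hset : MeasurableSet[others arr ch U (.inr (ℓ, j + 1))]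
      (⋃ x : {x : Option (I × ℕ) // x.map Prod.fst = some ℓ},
        {ω | transmission π.choose (U ω) (fun t ℓ => arr t ℓ ω)
          (fun ℓ t => ch ℓ t ω) (i + 1) = x}) := by
    refine MeasurableSet.iUnion fun x => measurableSet_transmission π.measurable_choose i
      (measurable_seed_others _) (fun s _ k => ?_) (fun s hs k => ?_) x
    · exact measurable_coin_others (arr := arr) (ch := ch) (y := .inl (s, k)) (by simp)
    · exact measurable_coin_others (arr := arr) (ch := ch) (y := .inr (k, s))
        (by simp; omega)
  have : (fun ω => attempt (Network.path arr ch U π ω) ℓ i) = fun ω => if ω ∈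
      (⋃ x : {x : Option (I × ℕ) // x.map Prod.fst = some ℓ},
        {ω | transmission π.choose (U ω) (fun t ℓ => arr t ℓ ω)
          (fun ℓ t => ch ℓ t ω) (i + 1) = x}) then 1 else 0 := by
    ext ω
    simp [attempt, Network.path, Policy.run, runOf]
  rw [this]
  exact Measurable.ite hset measurable_const measurable_const

end Attempts

/-! ### Rates of reception on a sample path -/

section Paths

variable {I : Type*}

lemma sum_Icc_one (f : ℕ → ℝ) (n : ℕ) :
    ∑ s ∈ Finset.Icc 1 n, f s = ∑ i ∈ Finset.range n, f (i + 1) := by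
  induction n with
  | zero => simp
  | succ n ih =>
    rw [← Finset.insert_Icc_right_eq_Icc_add_one (show 1 ≤ n + 1 by omega),
      Finset.sum_insert (by simp), ih, Finset.sum_range_succ, add_comm]

lemma card_arrived (r : Run I) (ℓ : I) (n : ℕ) :
    ((r.arrived ℓ n).card : ℝ) = ∑ i ∈ Finset.range n, coin (r.arr (i + 1) ℓ) := by
  rw [Run.arrived, Finset.card_filter, ← sum_Icc_one fun s => coin (r.arr s ℓ)]
  simp [coin]

lemma tendsto_card_arrived {r : Run I} {ℓ : I} {q : ℝ}
    (h : Tendsto (fun n : ℕ => (∑ i ∈ Finset.range n, coin (r.arr (i + 1) ℓ)) / (n : ℝ))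
      atTop (𝓝 q)) : Tendsto (fun t : ℕ => ((r.arrived ℓ t).card : ℝ) / t) atTop (𝓝 q) := by
  simpa only [card_arrived] using h

/-- The receptions of distinct packets are distinct successful transmissions. -/
lemma card_delivered_le [DecidableEq I] (r : Run I) (ℓ : I) {c : ℕ → Bool}
    (hok : ∀ t g, r.tx t = some (ℓ, g) → r.ok t = c t) (n : ℕ) :
    ((r.delivered ℓ n).card : ℝ)
      ≤ ∑ i ∈ Finset.range n, attempt r ℓ i * coin (c (i + 1)) := by
  have hsub : r.delivered ℓ n ⊆ ((Finset.Icc 1 n).filter fun s =>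
      (r.tx s).map Prod.fst = some ℓ ∧ c s = true).image
        fun s => ((r.tx s).map Prod.snd).getD 0 := by
    intro g hg
    obtain ⟨-, -, s, h1, h2, h3, h4⟩ := Run.mem_delivered.1 hg
    rw [hok s g h3] at h4
    exact Finset.mem_image.2 ⟨s, by simp [h1, h2, h3, h4], by simp [h3]⟩
  have h := (Finset.card_le_card hsub).trans Finset.card_image_le
  have h' : ((r.delivered ℓ n).card : ℝ) ≤ (((Finset.Icc 1 n).filter fun s =>
      (r.tx s).map Prod.fst = some ℓ ∧ c s = true).card : ℝ) := by exact_mod_cast h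
  refine h'.trans (le_of_eq ?_)
  rw [Finset.card_filter, Nat.cast_sum, sum_Icc_one]
  refine Finset.sum_congr rfl fun i _ => ?_
  by_cases h1 : (r.tx (i + 1)).map Prod.fst = some ℓ <;> by_cases h2 : c (i + 1) = true <;>
    simp [attempt, coin, h1, h2]

/-- If the average age converges, then the age grows sublinearly. -/
lemma tendsto_sup_delivered {r : Run I} {ℓ : I} {A : ℝ}
    (h : Tendsto (fun t => r.avgAge ℓ t) atTop (𝓝 A)) :
    Tendsto (fun t : ℕ => (((r.delivered ℓ t).sup id : ℕ) : ℝ) / t) atTop (𝓝 1) := by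
  have hratio : Tendsto (fun t : ℕ => (t : ℝ) / (t + 1 : ℕ)) atTop (𝓝 1) := by
    simpa using tendsto_natCast_div_add_atTop (1 : ℝ)
  have h1 := (tendsto_add_atTop_iff_nat 1).2 h
  have h2 := (h.mul hratio).sub h1
  have h3 := (h2.add_const 1).mul (hratio.inv₀ one_ne_zero)
  refine Tendsto.congr' ?_ (h3.trans (by simp))
  filter_upwards [eventually_gt_atTop 0] with t ht
  have ht' : (t : ℝ) ≠ 0 := by positivity
  have ht1 : ((t + 1 : ℕ) : ℝ) ≠ 0 := by positivity
  simp only [Run.avgAge]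
  rw [← Finset.insert_Icc_right_eq_Icc_add_one (show 1 ≤ t + 1 by omega),
    Finset.sum_insert (by simp), Run.age, Run.latestReceived, Nat.add_sub_cancel]
  field_simp
  ring

/-- The average gap of the received packets is at least the average gap `1 / q` of the arrivals, and
its inverse is the rate at which packets are received. -/
lemma mean_gap_of_avgAge {r : Run I} {ℓ : I} {A m q : ℝ} (hq : 0 < q)
    (harr : Tendsto (fun t : ℕ => ((r.arrived ℓ t).card : ℝ) / t) atTop (𝓝 q))
    (hsub : ∀ t, r.delivered ℓ t ⊆ r.arrived ℓ t)
    (h : Tendsto (fun t => r.avgAge ℓ t) atTop (𝓝 A)) (hm : HasMeanGap (r.delivered ℓ) m) :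
    1 / q ≤ m ∧ Tendsto (fun t : ℕ => ((r.delivered ℓ t).card : ℝ) / t) atTop (𝓝 (1 / m)) := by
  have hL := tendsto_sup_delivered h
  simp only [HasMeanGap, sum_gap] at hm
  have hpos : ∀ᶠ t : ℕ in atTop, 0 < t ∧ 0 < (r.delivered ℓ t).card := by
    filter_upwards [hL.eventually (lt_mem_nhds one_pos), eventually_gt_atTop 0] with t ht ht0
    refine ⟨ht0, Finset.card_pos.2 ?_⟩
    rw [Finset.nonempty_iff_ne_empty]
    intro he
    simp [he] at ht
  have hmq : 1 / q ≤ m := by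
    refine le_of_tendsto_of_tendsto (hL.div harr hq.ne') hm ?_
    filter_upwards [hpos] with t ⟨ht, hc⟩
    have ht' : (0 : ℝ) < t := by exact_mod_cast ht
    have hc' : (0 : ℝ) < (r.delivered ℓ t).card := by exact_mod_cast hc
    simp only [Pi.div_apply]
    rw [div_div_div_cancel_right₀ ht'.ne']
    gcongr
    exact hsub t
  refine ⟨hmq, ?_⟩
  have hm0 : 0 < m := lt_of_lt_of_le (by positivity) hmq
  refine (hL.div hm hm0.ne').congr' ?_
  filter_upwards [hpos, hL.eventually (lt_mem_nhds one_pos)] with t ⟨ht, hc⟩ h1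
  have ht' : (0 : ℝ) < t := by exact_mod_cast ht
  have hc' : (0 : ℝ) < (r.delivered ℓ t).card := by exact_mod_cast hc
  have hs : (((r.delivered ℓ t).sup id : ℕ) : ℝ) ≠ 0 := by
    intro h0
    rw [h0, zero_div] at h1
    exact lt_irrefl _ h1
  simp only [Pi.div_apply]
  field_simp

lemma card_sq_le_sum {t : ℕ} {V : Finset ℕ} (hV : V ⊆ Finset.Icc 1 t) :
    (V.card : ℝ) ^ 2 ≤ 2 * ∑ g ∈ V, ((t : ℝ) - g + 1) := by
  induction t generalizing V with
  | zero =>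
    have : V = ∅ := by simpa using hV
    simp [this]
  | succ t ih =>
    have hW : V.erase (t + 1) ⊆ Finset.Icc 1 t := by
      intro x hx
      have h1 := Finset.mem_Icc.1 (hV (Finset.mem_of_mem_erase hx))
      have h2 := Finset.ne_of_mem_erase hx
      exact Finset.mem_Icc.2 ⟨h1.1, by omega⟩
    have h := ih hW
    have hsum : ∑ g ∈ V.erase (t + 1), (((t + 1 : ℕ) : ℝ) - g + 1)
        = ∑ g ∈ V.erase (t + 1), ((t : ℝ) - g + 1) + (V.erase (t + 1)).card := by
      rw [Finset.card_eq_sum_ones, Nat.cast_sum, ← Finset.sum_add_distrib]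
      refine Finset.sum_congr rfl fun g _ => ?_
      push_cast
      ring
    by_cases hmem : t + 1 ∈ V
    · rw [← Finset.add_sum_erase V _ hmem, hsum, ← Finset.card_erase_add_one hmem]
      push_cast
      nlinarith
    · rw [Finset.erase_eq_of_notMem hmem] at h hsum
      rw [hsum]
      have : (0 : ℝ) ≤ V.card := Nat.cast_nonneg _
      linarith

/-- If the average latency converges, then almost all packets are received: `u` pending packets at
time `t` have a total latency of at least `u ^ 2 / 2`. -/
lemma tendsto_card_delivered_of_avgLatency [DecidableEq I] {r : Run I} {ℓ : I} {L q : ℝ}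
    (harr : Tendsto (fun t : ℕ => ((r.arrived ℓ t).card : ℝ) / t) atTop (𝓝 q))
    (hsub : ∀ t, r.delivered ℓ t ⊆ r.arrived ℓ t)
    (hcausal : ∀ s g, 1 ≤ s → r.tx s = some (ℓ, g) → g ≤ s)
    (h : Tendsto (fun t => r.avgLatency ℓ t) atTop (𝓝 L)) :
    Tendsto (fun t : ℕ => ((r.delivered ℓ t).card : ℝ) / t) atTop (𝓝 q) := by
  set u : ℕ → ℝ := fun t => ((r.arrived ℓ t \ r.delivered ℓ t).card : ℝ) with hu
  have hbound : ∀ t, u t ^ 2 ≤ 2 * ∑ g ∈ r.arrived ℓ t, r.latency ℓ g t := by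
    intro t
    refine (card_sq_le_sum (t := t) ((Finset.sdiff_subset).trans (Finset.filter_subset _ _))).trans
      (mul_le_mul_of_nonneg_left ?_ zero_le_two)
    rw [← Finset.sum_sdiff (hsub t)]
    refine le_add_of_le_of_nonneg (Finset.sum_le_sum fun g hg => ?_)
      (Finset.sum_nonneg fun g hg => ?_)
    · rw [Run.latency, Run.receivedSlot, if_neg (Finset.mem_sdiff.1 hg).2]
    · rw [Run.latency, Run.receivedSlot, if_pos hg]
      obtain ⟨-, -, s, h1, h2, h3, h4⟩ := Run.mem_delivered.1 hg
      have hle : s ≤ ((Finset.Icc 1 t).filter fun s =>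
          r.tx s = some (ℓ, g) ∧ r.ok s = true).sup id :=
        Finset.le_sup (f := id) (by simp [h1, h2, h3, h4])
      have hgs := (hcausal s g h1 h3).trans hle
      have : (g : ℝ) ≤ (((Finset.Icc 1 t).filter fun s =>
          r.tx s = some (ℓ, g) ∧ r.ok s = true).sup id : ℕ) := by exact_mod_cast hgs
      linarith
  have hu0 : Tendsto (fun t : ℕ => u t / t) atTop (𝓝 0) := by
    have h1 : Tendsto (fun t : ℕ => (u t / t) ^ 2) atTop (𝓝 0) := by
      have h2 := ((h.mul harr).mul tendsto_one_div_atTop_nhds_zero_nat).const_mul 2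
      rw [mul_zero, mul_zero] at h2
      refine squeeze_zero' (Eventually.of_forall fun t => sq_nonneg _) ?_ h2
      filter_upwards [eventually_gt_atTop 0] with t ht
      have ht' : (0 : ℝ) < t := by exact_mod_cast ht
      have h3 := hbound t
      rcases Nat.eq_zero_or_pos (r.arrived ℓ t).card with h0 | h0
      · have : u t = 0 := by
          have h4 := Finset.card_le_card (Finset.sdiff_subset (s := r.arrived ℓ t)
            (t := r.delivered ℓ t))
          simp only [hu]
          exact_mod_cast Nat.le_zero.1 (h0 ▸ h4)
        simp [this, h0]
      · have h0' : (0 : ℝ) < (r.arrived ℓ t).card := by exact_mod_cast h0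
        rw [Run.avgLatency, div_pow, div_le_iff₀ (by positivity)]
        refine h3.trans (le_of_eq ?_)
        field_simp
    have h2 := h1.sqrt
    simp only [Real.sqrt_sq_eq_abs, Real.sqrt_zero] at h2
    exact (tendsto_zero_iff_abs_tendsto_zero _).2 h2
  refine ((harr.sub hu0).congr fun t => ?_).trans (by simp)
  rw [← sub_div]
  congr 1
  have := Finset.card_sdiff_add_card_eq_card (hsub t)
  simp only [hu]
  rw [← this]
  push_cast
  ring

end Paths

/-! ### The lower bound for feasible policies -/

lemma HasGapVariance.nonneg {D : ℕ → Finset ℕ} {m v : ℝ} (h : HasGapVariance D m v) : 0 ≤ v :=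
  ge_of_tendsto' h fun _ => div_nonneg (Finset.sum_nonneg fun _ _ => sq_nonneg _)
    (Nat.cast_nonneg _)

namespace Network

variable {I : Type*} [Fintype I] {N : Network I}

lemma sum_users [DecidableEq I] (N : Network I) (f : I → ℝ) :
    ∑ ℓ, f ℓ = ∑ ℓ ∈ N.users .aoi, f ℓ + ∑ ℓ ∈ N.users .lat, f ℓ + ∑ ℓ ∈ N.users .thr, f ℓ := by
  simp only [users, Finset.sum_filter, ← Finset.sum_add_distrib]
  refine Finset.sum_congr rfl fun ℓ _ => ?_
  cases N.kind ℓ <;> simp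

/-- For average gaps `m` that are feasible and at least `1 / q`, twice the cost exceeds the bound by
a constant, whatever the variances: the variance `(1 - q) / q ^ 2` in the bound contributes at most
`(1 - q) / q ≤ m - 1`. -/
lemma F1Bound_add_le {T : I → ℝ} (hT : N.IsTarget T) (hN : N.Valid) {m v : I → ℝ}
    (hm : N.TargetFeasible m)
    (hmq : ∀ ℓ ∈ N.users .aoi, 1 / N.q ℓ ≤ m ℓ) (hv : ∀ ℓ ∈ N.users .aoi, 0 ≤ v ℓ) :
    N.F1Bound T + ∑ ℓ ∈ N.users .aoi, N.ρ ℓ / 2 ≤ 2 * N.F1At m v := by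
  have h1 : N.F1Bound T = N.targetObjective T + ∑ ℓ ∈ N.users .aoi, N.ρ ℓ := by
    rw [F1Bound, targetObjective, ← Finset.sum_add_distrib]
    exact Finset.sum_congr rfl fun ℓ _ => by ring
  have h2 : N.targetObjective m + ∑ ℓ ∈ N.users .aoi, N.ρ ℓ + ∑ ℓ ∈ N.users .aoi, N.ρ ℓ / 2
      ≤ 2 * N.F1At m v := by
    rw [F1At, targetObjective, Finset.mul_sum, ← Finset.sum_add_distrib, ← Finset.sum_add_distrib]
    refine Finset.sum_le_sum fun ℓ hℓ => ?_
    have hq := hN.q_pos ℓ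
    have hq1 := hN.q_le ℓ
    have hρ := hN.ρ_pos ℓ hℓ
    have hmℓ := hmq ℓ hℓ
    have hm0 : 0 < m ℓ := lt_of_lt_of_le (by positivity) hmℓ
    have e1 : (1 - N.q ℓ) / N.q ℓ ^ 2 / m ℓ ≤ 1 / N.q ℓ - 1 := by
      rw [div_le_iff₀ hm0]
      have : (1 - N.q ℓ) / N.q ℓ ^ 2 = (1 / N.q ℓ - 1) * (1 / N.q ℓ) := by field_simp
      rw [this]
      refine mul_le_mul_of_nonneg_left hmℓ ?_
      rw [sub_nonneg, le_div_iff₀ hq]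
      linarith
    have e2 : 0 ≤ v ℓ / m ℓ := div_nonneg (hv ℓ hℓ) hm0.le
    have e3 := mul_le_mul_of_nonneg_left (show m ℓ + (1 - N.q ℓ) / N.q ℓ ^ 2 / m ℓ + 2 + 1
      ≤ 2 * (m ℓ + v ℓ / m ℓ + 1) by linarith) (show 0 ≤ N.ρ ℓ / 2 by linarith)
    linarith
  have h3 := hT.2 m hm
  linarith

section LowerBound

variable [DecidableEq I] {Ω : Type*} [MeasurableSpace Ω] {P : Measure Ω}
  {arr : ℕ → I → Ω → Bool} {ch : I → ℕ → Ω → Bool} {U : Ω → ℝ}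

/-- Capacity constraint: if the users receive packets at the rates `R ℓ`, then the fractions
`R ℓ / p ℓ` of slots that this takes add up to at most `1`. -/
lemma sum_rate_div_le_one (hN : N.Valid) {r : Run I} {c : I → ℕ → Bool}
    (hok : ∀ ℓ t g, r.tx t = some (ℓ, g) → r.ok t = c ℓ t)
    (hatt : ∀ ℓ, Tendsto (fun n : ℕ => (∑ i ∈ Finset.range n,
      attempt r ℓ i * (coin (c ℓ (i + 1)) - N.p ℓ)) / (n : ℝ)) atTop (𝓝 0))
    {R : I → ℝ}
    (hR : ∀ ℓ, Tendsto (fun t : ℕ => ((r.delivered ℓ t).card : ℝ) / t) atTop (𝓝 (R ℓ))) :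
    ∑ ℓ, R ℓ / N.p ℓ ≤ 1 := by
  have hlim : Tendsto (fun n : ℕ => ∑ ℓ, ((r.delivered ℓ n).card : ℝ) / n / N.p ℓ) atTop
      (𝓝 (∑ ℓ, R ℓ / N.p ℓ)) := tendsto_finsetSum _ fun ℓ _ => (hR ℓ).div_const _
  have hlim' : Tendsto (fun n : ℕ => 1 + ∑ ℓ, (∑ i ∈ Finset.range n,
      attempt r ℓ i * (coin (c ℓ (i + 1)) - N.p ℓ)) / (n : ℝ) / N.p ℓ) atTop (𝓝 1) := by
    have := (tendsto_finsetSum Finset.univ fun ℓ _ => (hatt ℓ).div_const (N.p ℓ)).const_add 1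
    simpa using this
  refine le_of_tendsto_of_tendsto hlim hlim' ?_
  filter_upwards [eventually_gt_atTop 0] with n hn
  have hn' : (0 : ℝ) < n := by exact_mod_cast hn
  have hslots : ∑ ℓ, (∑ i ∈ Finset.range n, attempt r ℓ i) / (n : ℝ) ≤ 1 := by
    rw [← Finset.sum_div, Finset.sum_comm, div_le_one hn']
    exact (Finset.sum_le_sum fun i _ => sum_attempt_le r i).trans (by simp)
  refine le_trans ?_ (add_le_add_left hslots _)
  rw [← Finset.sum_add_distrib]
  refine Finset.sum_le_sum fun ℓ _ => ?_
  have hp := hN.p_pos ℓ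
  have h := card_delivered_le r ℓ (hok ℓ) n
  have hsplit : ∑ i ∈ Finset.range n, attempt r ℓ i * coin (c ℓ (i + 1))
      = ∑ i ∈ Finset.range n, attempt r ℓ i * (coin (c ℓ (i + 1)) - N.p ℓ)
        + N.p ℓ * ∑ i ∈ Finset.range n, attempt r ℓ i := by
    rw [Finset.mul_sum, ← Finset.sum_add_distrib]
    exact Finset.sum_congr rfl fun i _ => by ring
  rw [hsplit] at h
  calc ((r.delivered ℓ n).card : ℝ) / n / N.p ℓ
      ≤ (∑ i ∈ Finset.range n, attempt r ℓ i * (coin (c ℓ (i + 1)) - N.p ℓ)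
        + N.p ℓ * ∑ i ∈ Finset.range n, attempt r ℓ i) / n / N.p ℓ := by gcongr
    _ = _ := by field_simp; ring

/-- The packets received under a feasible policy have average gaps that are feasible for the convex
program and at least those of the arrivals. -/
lemma ae_targetFeasible [IsProbabilityMeasure P] (hM : N.IsModel P arr ch U) (hN : N.Valid)
    {π : Policy I} (hπ : N.Feasible P arr ch U π) :
    ∀ᵐ ω ∂P, ∀ m : I → ℝ,
      (∀ ℓ ∈ N.users .aoi, HasMeanGap ((path arr ch U π ω).delivered ℓ) (m ℓ)) →
      N.TargetFeasible m ∧ ∀ ℓ ∈ N.users .aoi, 1 / N.q ℓ ≤ m ℓ := by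
  filter_upwards [hπ, ae_all_iff.2 fun ℓ => ae_tendsto_attempts hM hN π ℓ,
    ae_all_iff.2 fun ℓ => ae_tendsto_arrivals hM hN ℓ] with ω ⟨hage, hlat, hthr⟩ hatt harr m hm
  set r := path arr ch U π ω with hr
  have hadm : ∀ t ℓ g, 1 ≤ t → r.tx t = some (ℓ, g) → 1 ≤ g ∧ g ≤ t ∧ r.arr g ℓ = true :=
    fun t ℓ g ht htx =>
      let h := π.admissible _ _ _ t ℓ g ht htx
      ⟨h.1, h.2.1, h.2.2.1⟩
  have hsub : ∀ ℓ t, r.delivered ℓ t ⊆ r.arrived ℓ t := fun ℓ t g hg => by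
    obtain ⟨h1, h2, s, h3, -, h4, -⟩ := Run.mem_delivered.1 hg
    exact Finset.mem_filter.2 ⟨Finset.mem_Icc.2 ⟨h1, h2⟩, (hadm s ℓ g h3 h4).2.2⟩
  have hok : ∀ ℓ t g, r.tx t = some (ℓ, g) → r.ok t = ch ℓ t ω := by
    intro ℓ t g htx
    have htx' : transmission π.choose (U ω) (fun t ℓ => arr t ℓ ω) (fun ℓ t => ch ℓ t ω) t
      = some (ℓ, g) := htx
    simp only [hr, path, Policy.run, runOf, htx', outcome]
  have hcard : ∀ ℓ, Tendsto (fun t : ℕ => ((r.arrived ℓ t).card : ℝ) / t) atTop (𝓝 (N.q ℓ)) :=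
    fun ℓ => tendsto_card_arrived (r := r) (harr ℓ)
  have haoi : ∀ ℓ ∈ N.users .aoi, 1 / N.q ℓ ≤ m ℓ ∧
      Tendsto (fun t : ℕ => ((r.delivered ℓ t).card : ℝ) / t) atTop (𝓝 (1 / m ℓ)) := fun ℓ hℓ => by
    obtain ⟨A, hA⟩ := hage ℓ hℓ
    exact mean_gap_of_avgAge (hN.q_pos ℓ) (hcard ℓ) (hsub ℓ) hA (hm ℓ hℓ)
  have hrate : ∀ ℓ, ∃ R : ℝ,
      Tendsto (fun t : ℕ => ((r.delivered ℓ t).card : ℝ) / t) atTop (𝓝 R) ∧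
      (ℓ ∈ N.users .aoi → R = 1 / m ℓ) ∧ (ℓ ∈ N.users .lat → R = N.q ℓ) ∧
      (ℓ ∈ N.users .thr → N.α ℓ ≤ R) := by
    intro ℓ
    rcases hk : N.kind ℓ with _ | _ | _
    · exact ⟨_, (haoi ℓ (by simp [users, hk])).2, by simp [users, hk]⟩
    · obtain ⟨L, hL⟩ := hlat ℓ (by simp [users, hk])
      exact ⟨_, tendsto_card_delivered_of_avgLatency (hcard ℓ) (hsub ℓ)
        (fun s g hs h => (hadm s ℓ g hs h).2.1) hL, by simp [users, hk]⟩
    · obtain ⟨R, hR, hlim⟩ := hthr ℓ (by simp [users, hk])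
      exact ⟨R, hlim, by simp [users, hk, hR]⟩
  choose R hR hRa hRl hRt using hrate
  have hcap := sum_rate_div_le_one hN hok hatt hR
  refine ⟨⟨?_, fun ℓ hℓ => ?_⟩, fun ℓ hℓ => (haoi ℓ hℓ).1⟩
  · rw [sum_users N] at hcap
    have e1 : ∑ ℓ ∈ N.users .aoi, R ℓ / N.p ℓ = ∑ ℓ ∈ N.users .aoi, 1 / (N.p ℓ * m ℓ) :=
      Finset.sum_congr rfl fun ℓ hℓ => by rw [hRa ℓ hℓ, div_div, mul_comm]
    have e2 : ∑ ℓ ∈ N.users .lat, R ℓ / N.p ℓ = ∑ ℓ ∈ N.users .lat, N.q ℓ / N.p ℓ :=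
      Finset.sum_congr rfl fun ℓ hℓ => by rw [hRl ℓ hℓ]
    have e3 : ∑ ℓ ∈ N.users .thr, N.α ℓ / N.p ℓ ≤ ∑ ℓ ∈ N.users .thr, R ℓ / N.p ℓ :=
      Finset.sum_le_sum fun ℓ hℓ => div_le_div_of_nonneg_right (hRt ℓ hℓ) (hN.p_pos ℓ).le
    rw [ζ]
    linarith
  · refine le_trans ?_ (haoi ℓ hℓ).1
    rw [le_div_iff₀ (hN.q_pos ℓ)]
    linarith [hN.q_le ℓ]

lemma F1Bound_lt_two_mul_minF1 [IsProbabilityMeasure P] {T : I → ℝ}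
    (hM : N.IsModel P arr ch U) (hN : N.Valid)
    (hA : (N.users .aoi).Nonempty) (hT : N.IsTarget T) :
    ((N.F1Bound T : ℝ) : EReal) < 2 * N.minF1 P arr ch U := by
  set c : ℝ := (N.F1Bound T + ∑ ℓ ∈ N.users .aoi, N.ρ ℓ / 2) / 2 with hc
  have hρ : 0 < ∑ ℓ ∈ N.users .aoi, N.ρ ℓ / 2 :=
    Finset.sum_pos (fun ℓ hℓ => half_pos (hN.ρ_pos ℓ hℓ)) hA
  have hle : ((c : ℝ) : EReal) ≤ N.minF1 P arr ch U := by
    refine le_iInf₂ fun π hπ => le_essInf_of_ae_le _ ?_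
    filter_upwards [ae_targetFeasible hM hN hπ] with ω hω
    refine le_sInf ?_
    rintro x ⟨m, v, hmv, rfl⟩
    obtain ⟨h1, h2⟩ := hω m fun ℓ hℓ => (hmv ℓ hℓ).1
    have h3 := F1Bound_add_le hT hN h1 h2 fun ℓ hℓ => (hmv ℓ hℓ).2.nonneg
    rw [EReal.coe_le_coe_iff, hc]
    linarith
  have h2 : ((2 * c : ℝ) : EReal) ≤ 2 * N.minF1 P arr ch U := by
    rw [EReal.coe_mul]
    exact mul_le_mul_of_nonneg_left hle (by norm_num)
  refine lt_of_lt_of_le ?_ h2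
  rw [EReal.coe_lt_coe_iff, hc]
  linarith

end LowerBound

section Selected

variable {Ω : Type*} [MeasurableSpace Ω] {P : Measure Ω} [IsProbabilityMeasure P]
  {arr : ℕ → I → Ω → Bool} {ch : I → ℕ → Ω → Bool} {U : Ω → ℝ} {T : I → ℝ}

lemma ae_selected_limits [DecidableEq I] (hM : N.IsModel P arr ch U) (hN : N.Valid)
    (hT : N.IsTarget T) (π : Policy I) :
    ∀ᵐ ω ∂P, ∀ ℓ ∈ N.users .aoi, ∃ m ∈ Set.Ico (T ℓ) (T ℓ + 1),
      HasMeanGap (N.selected T (path arr ch U π ω) ℓ) m ∧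
      HasGapVariance (N.selected T (path arr ch U π ω) ℓ) m ((1 - N.q ℓ) / N.q ℓ ^ 2) ∧
      Tendsto (fun t => (N.selected T (path arr ch U π ω) ℓ t).sup id) atTop atTop := by
  refine ae_all_iff.2 fun ℓ => ?_
  by_cases hℓ : ℓ ∈ N.users .aoi
  swap
  · exact Eventually.of_forall fun ω h => absurd h hℓ
  obtain ⟨θ, hθ, hm⟩ := hT.exists_threshold hN hℓ
  filter_upwards [ae_tendsto_active hM hN.q_pos hN.q_le θ ℓ,
    ae_tendsto_excess hM hN.q_pos hN.q_le θ ℓ] with ω h1 h2 _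
  exact ⟨_, hm, selected_limits (r := path arr ch U π ω) hθ (hN.q_pos ℓ) h1 h2⟩

lemma ae_arr_thr (hM : N.IsModel P arr ch U) (hN : N.Valid) :
    ∀ᵐ ω ∂P, ∀ t, ∀ k ∈ N.users .thr, arr t k ω = true := by
  refine ae_all_iff.2 fun t => ae_all_iff.2 fun k => ?_
  by_cases hk : k ∈ N.users .thr
  · have h : P {ω | arr t k ω = true} = 1 := by rw [hM.arr_law, hN.q_thr k hk, ENNReal.ofReal_one]
    have hms : MeasurableSet {ω | arr t k ω = true} :=
      hM.measurable_arr t k (measurableSet_singleton true)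
    filter_upwards [(mem_ae_iff_prob_eq_one hms).2 h] with ω hω _ using hω
  · exact Eventually.of_forall fun ω h => absurd h hk

end Selected

end Network

end Downlink

end

theorem mainTheorem1 {I : Type*} [Fintype I] [DecidableEq I]
    (N : Downlink.Network I) (hN : N.Valid) (hA : (N.users .aoi).Nonempty)
    {Ω : Type*} [MeasurableSpace Ω] (P : Measure Ω) [IsProbabilityMeasure P]
    (arr : ℕ → I → Ω → Bool) (ch : I → ℕ → Ω → Bool) (U : Ω → ℝ)
    (hM : N.IsModel P arr ch U)
    (T : I → ℝ) (hT : N.IsTarget T)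
    (π : Downlink.Policy I) (hπ : N.IsHierarchical T π) :
    -- the packets that arrive at the increments of the counters
    (∀ᵐ ω ∂P, ∀ ℓ ∈ N.users .aoi,
      ∃ m ∈ Set.Ico (T ℓ) (T ℓ + 1),
        Downlink.HasMeanGap (N.selected T (Downlink.Network.path arr ch U π ω) ℓ) m ∧
        Downlink.HasGapVariance (N.selected T (Downlink.Network.path arr ch U π ω) ℓ) m
          ((1 - N.q ℓ) / N.q ℓ ^ 2)) ∧
    (∀ᵐ ω ∂P, N.F1 (N.selected T (Downlink.Network.path arr ch U π ω)) <
      ((N.F1Bound T : ℝ) : EReal)) ∧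
    -- the packets that are delivered, if the packets above are all transmitted
    (∀ᵐ ω ∂P, ∀ ℓ ∈ N.users .aoi,
      (∀ t, ∀ g ∈ N.selected T (Downlink.Network.path arr ch U π ω) ℓ t,
        ∃ s, g ∈ (Downlink.Network.path arr ch U π ω).delivered ℓ s) →
      ∃ m ∈ Set.Ico (T ℓ) (T ℓ + 1),
        Downlink.HasMeanGap ((Downlink.Network.path arr ch U π ω).delivered ℓ) m ∧
        Downlink.HasGapVariance ((Downlink.Network.path arr ch U π ω).delivered ℓ) m
          ((1 - N.q ℓ) / N.q ℓ ^ 2)) ∧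
    (∀ᵐ ω ∂P,
      (∀ ℓ ∈ N.users .aoi, ∀ t, ∀ g ∈ N.selected T (Downlink.Network.path arr ch U π ω) ℓ t,
        ∃ s, g ∈ (Downlink.Network.path arr ch U π ω).delivered ℓ s) →
      N.F1 (Downlink.Network.path arr ch U π ω).delivered < ((N.F1Bound T : ℝ) : EReal)) ∧
    -- comparison with the feasible causal policies
    ((N.F1Bound T : ℝ) : EReal) < 2 * N.minF1 P arr ch U := by
  have hsel := Downlink.Network.ae_selected_limits hM hN hT π
  have hdel : ∀ᵐ ω ∂P, ∀ ℓ ∈ N.users .aoi,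
      (∀ t, ∀ g ∈ N.selected T (Downlink.Network.path arr ch U π ω) ℓ t,
        ∃ s, g ∈ (Downlink.Network.path arr ch U π ω).delivered ℓ s) →
      ∃ m ∈ Set.Ico (T ℓ) (T ℓ + 1),
        Downlink.HasMeanGap ((Downlink.Network.path arr ch U π ω).delivered ℓ) m ∧
        Downlink.HasGapVariance ((Downlink.Network.path arr ch U π ω).delivered ℓ) m
          ((1 - N.q ℓ) / N.q ℓ ^ 2) := by
    filter_upwards [hsel, Downlink.Network.ae_arr_thr hM hN] with ω hω harr ℓ hℓ hall
    obtain ⟨m, hm, h1, h2, h3⟩ := hω ℓ hℓ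
    exact ⟨m, hm, Downlink.Network.delivered_limits (hπ _ _ _ harr) hℓ hall h3 h1 h2⟩
  refine ⟨?_, ?_, hdel, ?_, Downlink.Network.F1Bound_lt_two_mul_minF1 hM hN hA hT⟩
  · filter_upwards [hsel] with ω hω ℓ hℓ
    obtain ⟨m, hm, h1, h2, -⟩ := hω ℓ hℓ
    exact ⟨m, hm, h1, h2⟩
  · filter_upwards [hsel] with ω hω
    refine Downlink.Network.F1_lt_F1Bound hN hA hT fun ℓ hℓ => ?_
    obtain ⟨m, hm, h1, h2, -⟩ := hω ℓ hℓ
    exact ⟨m, hm, h1, h2⟩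
  · filter_upwards [hdel] with ω hω hall
    exact Downlink.Network.F1_lt_F1Bound hN hA hT fun ℓ hℓ => hω ℓ hℓ (hall ℓ hℓ)
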